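/- Theorem 4.2. Setting. Let $(X,d,|\cdot|)$ be a space of homogeneous type: $d$ is a quasimetric on $X$ (it satisfies $d(x,y)\le K_X(d(x,z)+d(z,y))$), all balls $B(x,r)=\{y:d(x,y)<r\}$ are open in the topology induced by $d$, and $|\cdot|$ is a Borel measure with $0<|B(x,2r)|\le C_d|B(x,r)|<\infty$ for all $x\in X$, $r>0$. Fix a system of dyadic cubes $\mathscr Q=\bigcup_{n\in\mathbb Z}\mathscr Q_n$ of Christ–David type with scale $q\in(0,1)$. That is, with uniform constants $C_1,C_2,C_3,\eta>0$ and $N\in\mathbb N$: each $\mathscr Q_n$ is a countable collection of open sets covering $X$ up to a null set; if $k\le n$, $A\in\mathscr Q_k$, $B\in\mathscr Q_n$, then $B\subset A$ or $A\cap B=\emptyset$, and every $B\in\mathscr Q_n$ lies in exactly one cube of $\mathscr Q_k$; every $A\in\mathscr Q_n$ has a center $m_A\in A$ with $B(m_A,C_1q^n)\subset A\subset B(m_A,C_2q^n)$, satisfies $|\{x\in A:d(x,X\setminus A)\le tq^n\}|<C_3t^\eta|A|$ for all $t>0$, contains at most $N$ cubes of $\mathscr Q_{n+1}$, and is, up to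 a null set, the union of at most $N$ cubes of $\mathscr Q_{n+1}$. A cube is always considered together with its level, $\operatorname{lev}A=n$ for $A\in\mathscr Q_n$. For $r>0$ put $r\diamond A=\{y:d(A,y)<rq^{\operatorname{lev}A}\}$. Fix $C_R>0$. For $m>0$, a shift relation is a set $\tau\subset\bigcup_n\mathscr Q_n\times\mathscr Q_n$ with $Q\subset m\diamond P$ for all $(P,Q)\in\tau$, together with a finite partition $\tau_1,\dots,\tau_M$ of $\tau$ such that each $\tau_k$ is (the graph of) a bijective function between its two projections, and a finite partition of each $\tau_k$ into $\mathscr G_{k,1},\dots,\mathscr G_{k,M_k}$ such that $(C_R\diamond R_1)\cap(C_R\diamond R_2)=\emptyset$ whenever $(P_1,Q_1),(P_2,Q_2)\in\mathscr G_{k,j}$, $P_1\ne P_2$, $\operatorname{lev}P_1=\operatorname{lev}P_2$, $R_1\in\{P_1,Q_1\}$, $R_2\in\{P_2,Q_2\}$. For an integer $\ell\ge1$ and $0\le i\le\ell-1$ let $\mathscr H^{(\ell)}_{k,j,i}$ be the set of all pairs of $\mathscr G_{k,j}$ whose level is congruent to $i$ modulo $\ell$, and let $\operatorname{proj}_1$,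 $\operatorname{proj}_2$ denote the projections of a relation to its first and second coordinates. A Haar system with constant $C_h>0$ is a family of bounded measurable functions $h_Q:X\to\mathbb R$, $Q\in\mathscr Q$, such that $h_Q=0$ outside $Q$; $\|h_Q\|_\infty\le C_h\frac1{|P|+|Q|}\int|h_P|$ for all $(P,Q)\in\tau$; and for each $k$ the families $\{h_P:P\in\operatorname{proj}_1\tau_k\}$ and $\{h_Q:Q\in\operatorname{proj}_2\tau_k\}$ are, separately, martingale difference sequences: for some total order of the indices, each function except possibly a first one has integral zero over every event of the $\sigma$-algebra generated by its predecessors. For a Banach space $E$ and $1<p<\infty$ let $T_k$ be the linear extension of $h_P\mapsto h_Q$ if $(P,Q)\in\tau_k$, $h_P\mapsto0$ if there is no such $Q$; that is, $T_k\big(\sum_P x_Ph_P\big)=\sum_P x_P\,T_kh_P$ with $x_P\in E$. Finally, with $\langle f,h_P\rangle=\int f\,h_P\,d|\cdot|\in E$, let $$H^{(\ell)}_{k,j,i}=\Big\{f\in L^p_E(X): f=\sum_{P\in\operatorname{proj}_1(\mathscr H^{(\ell)}_{k,j,i})}\langle f,h_P\rangle h_P\Big\},$$ the series converging unconditionally in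 $L^p_E(X)$. Statement. There is a constant $\beta>0$, depending only on $X$ (with $\mathscr Q$ and $C_R$ fixed), such that for every UMD space $E$, every $1<p<\infty$ and every $C_h>0$ there is a constant $C$, depending only on $p$, $X$, $E$ and $C_h$, with the following property. For all $m>0$, all shift relations with parameter $m$ (partitioned and split as above), all Haar systems with constant $C_h$, all integers $\ell\ge1$ with $(1+m)q^\ell\le\beta$, and all $1\le k\le M$, $1\le j\le M_k$, $0\le i\le\ell-1$: (a) for all finite sums, $\big\|\sum_P x_P\,T_kh_P\big\|_{L^p_E(X)}\le C\,\big\|\sum_P x_Ph_P\big\|_{L^p_E(X)}$, where $P\in\operatorname{proj}_1(\mathscr H^{(\ell)}_{k,j,i})$ and $x_P\in E$; (b) for all $f\in H^{(\ell)}_{k,j,i}$ the series $T_kf=\sum_{P\in\operatorname{proj}_1(\mathscr H^{(\ell)}_{k,j,i})}\langle f,h_P\rangle\,T_kh_P$ converges unconditionally in $L^p_E(X)$, and $\|T_kf\|_{L^p_E(X)}\le C\,\|f\|_{L^p_E(X)}$. -/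

import Mathlib

open MeasureTheory ProbabilityTheory Filter Set
open scoped ENNReal NNReal

universe u v

/-! ## Spaces of homogeneous type -/

/-- The ball `B(x, r) = {y : d(x, y) < r}`. -/
def qBall {X : Type u} (d : X → X → ℝ) (x : X) (r : ℝ) : Set X := {y | d x y < r}

/-- `B(A, r) = {y : d(A, y) < r}` where `d(A, y) = inf_{a ∈ A} d(a, y)` (and `inf ∅ = ∞`);
the infimum is `< r` exactly if some `a ∈ A` has `d(a, y) < r`. -/
def qNhd {X : Type u} (d : X → X → ℝ) (A : Set X) (r : ℝ) : Set X := {y | ∃ a ∈ A, d a y < r}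

/-- `d` is a quasimetric. -/
structure IsQuasimetric {X : Type u} (d : X → X → ℝ) : Prop where
  nonneg : ∀ x y, 0 ≤ d x y
  eq_zero_iff : ∀ x y, d x y = 0 ↔ x = y
  symm : ∀ x y, d x y = d y x
  quasi_triangle : ∃ K : ℝ, 1 ≤ K ∧ ∀ x y z, d x y ≤ K * (d x z + d z y)

/-- `(X, d, μ)` is a space of homogeneous type: `d` is a quasimetric, the topology (whose Borel sets
are the measurable sets, by the `BorelSpace` assumption) is the one induced by `d`, all balls are
open, and the Borel measure `μ` is doubling. -/
structure IsHomogeneousType {X : Type u} [TopologicalSpace X] [MeasurableSpace X] [BorelSpace X]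
    (d : X → X → ℝ) (μ : Measure X) : Prop where
  quasimetric : IsQuasimetric d
  isOpen_iff : ∀ s : Set X, IsOpen s ↔ ∀ x ∈ s, ∃ r : ℝ, 0 < r ∧ qBall d x r ⊆ s
  isOpen_ball : ∀ (x : X) (r : ℝ), 0 < r → IsOpen (qBall d x r)
  doubling : ∃ Cd : ℝ, 0 < Cd ∧ ∀ (x : X) (r : ℝ), 0 < r →
    0 < μ (qBall d x (2 * r)) ∧
    μ (qBall d x (2 * r)) ≤ ENNReal.ofReal Cd * μ (qBall d x r) ∧
    μ (qBall d x r) < ∞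

/-! ## Dyadic cubes -/

/-- The boundary layer `{x ∈ A : d(x, X \ A) ≤ s}`, with `d(x, ∅) = ∞`. -/
def boundaryLayer {X : Type u} (d : X → X → ℝ) (A : Set X) (s : ℝ) : Set X :=
  {x | x ∈ A ∧ ∀ ε : ℝ, 0 < ε → ∃ y, y ∉ A ∧ d x y < s + ε}

/-- A system of dyadic cubes (in the sense of Christ and David) with its structural constants. -/
structure DyadicSystem {X : Type u} [TopologicalSpace X] [MeasurableSpace X]
    (d : X → X → ℝ) (μ : Measure X) where
  /-- the collection of the cubes of level `n` -/
  cubes : ℤ → Set (Set X)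
  /-- the center of a cube of level `n` -/
  center : ℤ → Set X → X
  q : ℝ
  C₁ : ℝ
  C₂ : ℝ
  C₃ : ℝ
  η : ℝ
  N : ℕ
  q_pos : 0 < q
  q_lt_one : q < 1
  C₁_pos : 0 < C₁
  C₂_pos : 0 < C₂
  C₃_pos : 0 < C₃
  η_pos : 0 < η
  isOpen_cube : ∀ n, ∀ A ∈ cubes n, IsOpen A
  center_mem : ∀ n, ∀ A ∈ cubes n, center n A ∈ A
  cover : ∀ n, ∀ᵐ x ∂μ, x ∈ ⋃₀ cubes n
  nested : ∀ k n : ℤ, k ≤ n → ∀ A ∈ cubes k, ∀ B ∈ cubes n, B ⊆ A ∨ A ∩ B = ∅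
  exists_unique_ancestor : ∀ k n : ℤ, k ≤ n → ∀ B ∈ cubes n, ∃! A, A ∈ cubes k ∧ B ⊆ A
  ball_subset : ∀ n, ∀ A ∈ cubes n, qBall d (center n A) (C₁ * q ^ n) ⊆ A
  subset_ball : ∀ n, ∀ A ∈ cubes n, A ⊆ qBall d (center n A) (C₂ * q ^ n)
  boundary_small : ∀ n, ∀ A ∈ cubes n, ∀ t : ℝ, 0 < t →
    μ (boundaryLayer d A (t * q ^ n)) < ENNReal.ofReal (C₃ * t ^ η) * μ A
  countable : ∀ n, (cubes n).Countable
  children_card : ∀ n, ∀ A ∈ cubes n, {B | B ∈ cubes (n + 1) ∧ B ⊆ A}.encard ≤ N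
  children_cover : ∀ n, ∀ A ∈ cubes n, ∃ S ⊆ cubes (n + 1), S.encard ≤ N ∧ A =ᵐ[μ] ⋃₀ S

namespace DyadicSystem

variable {X : Type u} [TopologicalSpace X] [MeasurableSpace X] {d : X → X → ℝ} {μ : Measure X}

/-- A cube together with its level (the same subset of `X` may be a cube of several levels). -/
structure Cube (D : DyadicSystem d μ) where
  lev : ℤ
  carrier : Set X
  mem : carrier ∈ D.cubes lev

/-- `r ⋄ A = B(A, r q^{lev A})`. -/
def diamond (D : DyadicSystem d μ) (r : ℝ) (A : D.Cube) : Set X :=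
  qNhd d A.carrier (r * D.q ^ A.lev)

end DyadicSystem

/-! ## The shift relation and its splitting -/

/-- First projection of a relation. -/
def proj₁ {α : Type u} (ρ : Set (α × α)) : Set α := {P | ∃ Q, (P, Q) ∈ ρ}

/-- Second projection of a relation. -/
def proj₂ {α : Type u} (ρ : Set (α × α)) : Set α := {Q | ∃ P, (P, Q) ∈ ρ}

/-- A shift relation `τ` with parameter `m`, its partition into bijective functions `τ_k`, and a
splitting of each `τ_k` into collections `G_{k,j}` that are separated with constant `CR`. -/
structure ShiftRelation {X : Type u} [TopologicalSpace X] [MeasurableSpace X] {d : X → X → ℝ}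
    {μ : Measure X} (D : DyadicSystem d μ) (m CR : ℝ) where
  τ : Set (D.Cube × D.Cube)
  same_level : ∀ P Q, (P, Q) ∈ τ → P.lev = Q.lev
  subset_diamond : ∀ P Q, (P, Q) ∈ τ → Q.carrier ⊆ D.diamond m P
  /-- the number of the `τ_k` -/
  M : ℕ
  part : Fin M → Set (D.Cube × D.Cube)
  part_union : ⋃ k, part k = τ
  part_disjoint : Pairwise fun k k' => Disjoint (part k) (part k')
  /-- `τ_k` is a function ... -/
  part_functional : ∀ k P Q Q', (P, Q) ∈ part k → (P, Q') ∈ part k → Q = Q'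
  /-- ... and is injective, hence a bijection between its two projections -/
  part_injective : ∀ k P P' Q, (P, Q) ∈ part k → (P', Q) ∈ part k → P = P'
  /-- the number of the collections into which `τ_k` is split -/
  Mk : Fin M → ℕ
  G : ∀ k, Fin (Mk k) → Set (D.Cube × D.Cube)
  G_union : ∀ k, ⋃ j, G k j = part k
  G_disjoint : ∀ k, Pairwise fun j j' => Disjoint (G k j) (G k j')
  /-- distinct cubes `P₁, P₂` of one level in the first projection of `G_{k,j}`: each of `P₁`,
  `τ_k(P₁)` is separated from each of `P₂`, `τ_k(P₂)` -/
  separated : ∀ k j P₁ Q₁ P₂ Q₂, (P₁, Q₁) ∈ G k j → (P₂, Q₂) ∈ G k j → P₁ ≠ P₂ →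
    P₁.lev = P₂.lev → ∀ R₁ R₂, (R₁ = P₁ ∨ R₁ = Q₁) → (R₂ = P₂ ∨ R₂ = Q₂) →
      D.diamond CR R₁ ∩ D.diamond CR R₂ = ∅

/-- The collection `ℋ^{(ℓ)}_{k,j,i}`: the pairs of `G_{k,j}` with levels in `i + ℓℤ`. -/
def ShiftRelation.levelBlock {X : Type u} [TopologicalSpace X] [MeasurableSpace X] {d : X → X → ℝ}
    {μ : Measure X} {D : DyadicSystem d μ} {m CR : ℝ} (S : ShiftRelation D m CR) (ℓ : ℕ)
    (k : Fin S.M) (j : Fin (S.Mk k)) (i : ℕ) : Set (D.Cube × D.Cube) :=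
  {PQ | PQ ∈ S.G k j ∧ ∃ r : ℤ, PQ.1.lev = i + r * ℓ ∧ PQ.2.lev = i + r * ℓ}

/-! ## Haar functions -/

/-- The family `(h_P)_{P ∈ I}` is a martingale difference sequence: for some total order of the
indices, `h_P` has integral zero over every event of the σ-algebra generated by the functions that
precede it, i.e. its conditional expectation given its past vanishes. As usual there is no
condition on a very first difference. -/
def IsMartingaleDifferenceFamily {X : Type u} [MeasurableSpace X] {ι : Type u} (μ : Measure X)
    (I : Set ι) (h : ι → X → ℝ) : Prop :=
  ∃ _ : LinearOrder ι, ∀ P ∈ I, (∃ R ∈ I, R < P) → ∀ A : Set X,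
    MeasurableSet[⨆ R ∈ {R | R ∈ I ∧ R < P}, MeasurableSpace.comap (h R) inferInstance] A →
      ∫ x in A, h P x ∂μ = 0

/-- A system of (bounded, measurable) Haar functions adapted to a shift relation, with constant
`Ch`. -/
structure HaarSystem {X : Type u} [TopologicalSpace X] [MeasurableSpace X] {d : X → X → ℝ}
    {μ : Measure X} {D : DyadicSystem d μ} {m CR : ℝ} (S : ShiftRelation D m CR) (Ch : ℝ) where
  h : D.Cube → X → ℝ
  measurable : ∀ Q, Measurable (h Q)
  bounded : ∀ Q, MemLp (h Q) ∞ μ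
  support_subset : ∀ Q, Function.support (h Q) ⊆ Q.carrier
  norm_le : ∀ P Q, (P, Q) ∈ S.τ → eLpNorm (h Q) ∞ μ ≤
    ENNReal.ofReal (Ch * (1 / (μ.real P.carrier + μ.real Q.carrier)) * ∫ x, |h P x| ∂μ)
  mds_fst : ∀ k, IsMartingaleDifferenceFamily μ (proj₁ (S.part k)) h
  mds_snd : ∀ k, IsMartingaleDifferenceFamily μ (proj₂ (S.part k)) h

section HaarSpaces

variable {X : Type u} [TopologicalSpace X] [MeasurableSpace X] [BorelSpace X]
  {d : X → X → ℝ} {μ : Measure X} {D : DyadicSystem d μ} {m CR Ch : ℝ} {S : ShiftRelation D m CR}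
  {E : Type v} [NormedAddCommGroup E] [NormedSpace ℝ E]

theorem DyadicSystem.Cube.measure_ne_top (hX : IsHomogeneousType d μ) (A : D.Cube) :
    μ A.carrier ≠ ∞ := by
  obtain ⟨Cd, -, h⟩ := hX.doubling
  exact ne_top_of_le_ne_top
    (h (D.center A.lev A.carrier) (D.C₂ * D.q ^ A.lev)
      (mul_pos D.C₂_pos (zpow_pos D.q_pos _))).2.2.ne
    (measure_mono (D.subset_ball _ _ A.mem))

theorem HaarSystem.memLp_smul (hX : IsHomogeneousType d μ) (H : HaarSystem S Ch) (p : ℝ≥0∞)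
    (P : D.Cube) (x : E) : MemLp (fun y => H.h P y • x) p μ := by
  have h1 : MemLp (H.h P) p μ :=
    (H.bounded P).mono_exponent_of_measure_support_ne_top
      (fun y hy => by
        by_contra hne
        exact hy (H.support_subset P hne)) (P.measure_ne_top hX) le_top
  exact ((ContinuousLinearMap.id ℝ ℝ).smulRight x).comp_memLp' h1

/-- The element `h_P x` of `L^p_E(X)`, for `x ∈ E`. -/
noncomputable def HaarSystem.vec (hX : IsHomogeneousType d μ) (H : HaarSystem S Ch) (p : ℝ≥0∞)
    (P : D.Cube) (x : E) : Lp E p μ :=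
  (H.memLp_smul hX p P x).toLp _

open Classical in
/-- The image `T_k (h_P x)`: it is `h_Q x` if `(P, Q) ∈ τ_k`, and `0` if there is no such `Q`. -/
noncomputable def HaarSystem.shiftVec (hX : IsHomogeneousType d μ) (H : HaarSystem S Ch)
    (p : ℝ≥0∞) (k : Fin S.M) (P : D.Cube) (x : E) : Lp E p μ :=
  if hP : ∃ Q, (P, Q) ∈ S.part k then H.vec hX p hP.choose x else 0

theorem HaarSystem.shiftVec_eq (hX : IsHomogeneousType d μ) (H : HaarSystem S Ch)
    (p : ℝ≥0∞) (k : Fin S.M) (P Q : D.Cube) (hPQ : (P, Q) ∈ S.part k) (x : E) :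
    H.shiftVec hX p k P x = H.vec hX p Q x := by
  have hP : ∃ Q, (P, Q) ∈ S.part k := ⟨Q, hPQ⟩
  rw [HaarSystem.shiftVec, dif_pos hP, S.part_functional k P _ Q hP.choose_spec hPQ]

/-- `⟨f, h_P⟩ = ∫ f h_P dμ ∈ E`. -/
noncomputable def HaarSystem.coeff (H : HaarSystem S Ch) {p : ℝ≥0∞} (f : Lp E p μ)
    (P : D.Cube) : E :=
  ∫ y, H.h P y • f y ∂μ

/-- The subspace of all `f ∈ L^p_E(X)` with `f = ∑_{P ∈ I} ⟨f, h_P⟩ h_P`, with (unconditional)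
convergence in `L^p_E(X)`. -/
def HaarSystem.haarSpace (hX : IsHomogeneousType d μ) (H : HaarSystem S Ch) (p : ℝ≥0∞)
    [Fact (1 ≤ p)] (E : Type v) [NormedAddCommGroup E] [NormedSpace ℝ E] (I : Set D.Cube) :
    Set (Lp E p μ) :=
  {f | HasSum (fun P : I => H.vec hX p (P : D.Cube) (H.coeff f P)) f}

end HaarSpaces

/-! ## UMD spaces -/

/-- `E` is a UMD space: for every `1 < p < ∞` the differences of `E`-valued `L^p`-martingales on
probability spaces are unconditional in `L^p`, with a uniform constant. -/
def IsUMD (E : Type v) [NormedAddCommGroup E] [NormedSpace ℝ E] [CompleteSpace E] : Prop :=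
  ∀ p : ℝ≥0∞, 1 < p → p < ∞ → ∃ C : ℝ≥0,
    ∀ (Ω : Type u) (mΩ : MeasurableSpace Ω) (ν : Measure Ω) (_ : IsProbabilityMeasure ν)
      (ℱ : Filtration ℕ mΩ) (f : ℕ → Ω → E), Martingale f ℱ ν → (∀ n, MemLp (f n) p ν) →
      ∀ ε : ℕ → ℝ, (∀ n, ε n = 1 ∨ ε n = -1) → ∀ N : ℕ,
        eLpNorm (fun ω => ∑ n ∈ Finset.range N, ε n • (f (n + 1) ω - f n ω)) p ν
          ≤ C * eLpNorm (fun ω => f N ω - f 0 ω) p ν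

/-! Each of the families `h_P` and `h_Q` is a martingale difference sequence, so in a UMD space
random signs can be inserted into `∑ h_P x_P` and removed from `∑ h_Q x_Q` at the cost of a
constant. Once the signs are there, Kahane's contraction principle compares sums at each point of
`X` separately: `h_Q` may be replaced by any function that dominates it, and `|h_P|` by `h_P`. It
remains to dominate `|h_Q|` by a multiple of an average of `|h_P|` over a set `A_P` containing `P ∪
Q`, and to bound these averaging operators. The latter is Bourgain's vector-valued form of Stein's
inequality, `HasUMDConstant.eLpNorm_sign_average_le`, valid when the sets `A_P` are nested.
`HasUMDConstant.eLpNorm_sum_le_of_dominated` puts these steps together.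

The unions `P ∪ Q` are not nested, but they can be enlarged to a nested family inside the regions
`(C_R ⋄ P) ∪ (C_R ⋄ Q)` (`exists_nested_enlargement`). On one level these regions are disjoint by
separation. Across levels, the smallness of `(1 + m) q^ℓ` makes a finer region so small that it lies
in the coarser region as soon as it meets the coarser cubes (`ShiftRelation.exists_level_gap`). By
doubling, the measure of `A_P` is at most a constant times `|P| + |Q|`, so the Haar size condition
gives the domination. Neither this constant nor the probabilistic ones involve `m` or `ℓ`.

Two orders are in play and need not agree: unconditionality uses the order of the martingale
differences, Stein's inequality the order of the levels. Both appear only inside inequalities for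
signed sums, which do not depend on an enumeration. Finite sums live on a set of finite measure, so
conditioning on it provides the probability space that UMD asks for. -/

/-! ## Random signs -/

/-- The sign `±1` encoded by a boolean. -/
def boolSign (b : Bool) : ℝ := if b then 1 else -1

theorem boolSign_eq (b : Bool) : boolSign b = 1 ∨ boolSign b = -1 := by
  cases b <;> simp [boolSign]

theorem boolSign_not (b : Bool) : boolSign (!b) = -boolSign b := by
  cases b <;> simp [boolSign]

theorem abs_boolSign (b : Bool) : |boolSign b| = 1 := by
  cases b <;> simp [boolSign]

/-- The uniform probability measure on the `N`-tuples of signs. -/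
noncomputable def signMeasure (N : ℕ) : Measure (Fin N → Bool) :=
  ((Fintype.card (Fin N → Bool) : ℝ≥0∞))⁻¹ • Measure.count

instance (N : ℕ) : IsProbabilityMeasure (signMeasure N) := by
  constructor
  simp only [signMeasure, Measure.smul_apply, smul_eq_mul]
  rw [Measure.count_apply_finite _ finite_univ]
  rw [Set.Finite.toFinset_univ, Finset.card_univ]
  exact ENNReal.inv_mul_cancel (by simp) (by simp)

theorem lintegral_signMeasure {N : ℕ} (f : (Fin N → Bool) → ℝ≥0∞) :
    ∫⁻ ω, f ω ∂signMeasure N = (Fintype.card (Fin N → Bool) : ℝ≥0∞)⁻¹ * ∑ ω, f ω := by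
  rw [signMeasure, lintegral_smul_measure, lintegral_count, tsum_fintype, smul_eq_mul]

theorem integral_signMeasure {E : Type v} [NormedAddCommGroup E] [NormedSpace ℝ E]
    [CompleteSpace E] {N : ℕ}
    (f : (Fin N → Bool) → E) :
    ∫ ω, f ω ∂signMeasure N = (Fintype.card (Fin N → Bool) : ℝ)⁻¹ • ∑ ω, f ω := by
  rw [signMeasure, integral_smul_measure, integral_fintype Integrable.of_finite]
  simp [measureReal_def]

/-- Flip the `i`-th sign. -/
def flipSign {N : ℕ} (i : Fin N) (ω : Fin N → Bool) : Fin N → Bool :=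
  Function.update ω i (!ω i)

theorem flipSign_involutive {N : ℕ} (i : Fin N) : Function.Involutive (flipSign i) := by
  intro ω
  simp [flipSign]

theorem flipSign_same {N : ℕ} (i : Fin N) (ω : Fin N → Bool) : flipSign i ω i = !ω i := by
  simp [flipSign]

theorem flipSign_of_ne {N : ℕ} {i j : Fin N} (h : j ≠ i) (ω : Fin N → Bool) :
    flipSign i ω j = ω j := by
  simp [flipSign, h]

/-! ## The contraction principle -/

section Contraction

variable {E : Type v} [NormedAddCommGroup E] [NormedSpace ℝ E]

/-- Kahane's contraction principle for `p`-th moments of sums with random signs. -/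
theorem sum_norm_rpow_sign_contraction {N : ℕ} {p : ℝ} (hp : 1 ≤ p) (y : Fin N → E)
    (b c : Fin N → ℝ) (hcb : ∀ i, |c i| ≤ |b i|) :
    ∑ ω : Fin N → Bool, ‖∑ i, (boolSign (ω i) * c i) • y i‖ ^ p ≤
      ∑ ω : Fin N → Bool, ‖∑ i, (boolSign (ω i) * b i) • y i‖ ^ p := by
  -- The moment is convex in the multipliers `θ`, and at a vertex of the cube `[-1, 1]^N` it equals
  -- the moment with all multipliers 1, because the signs are symmetric. A convex function on the
  -- cube is bounded by a vertex value.
  set Φ : (Fin N → ℝ) → ℝ := fun θ =>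
    ∑ ω : Fin N → Bool, ‖∑ i, (θ i * (boolSign (ω i) * b i)) • y i‖ ^ p with hΦ
  have hconv : ConvexOn ℝ univ Φ := by
    have key : ∀ ω : Fin N → Bool, ConvexOn ℝ univ
        (fun θ : Fin N → ℝ => ‖∑ i, (θ i * (boolSign (ω i) * b i)) • y i‖ ^ p) := by
      intro ω
      let T : (Fin N → ℝ) →ₗ[ℝ] E :=
        ∑ i, (LinearMap.toSpanSingleton ℝ E ((boolSign (ω i) * b i) • y i)) ∘ₗ LinearMap.proj i
      have hT : ∀ θ, T θ = ∑ i, (θ i * (boolSign (ω i) * b i)) • y i := by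
        intro θ
        simp [T, LinearMap.sum_apply, smul_smul]
      have h1 : ConvexOn ℝ univ (fun θ => ‖T θ‖) :=
        (convexOn_norm convex_univ).comp_linearMap T
      have himg : (fun θ => ‖T θ‖) '' univ ⊆ Ici 0 := by
        rintro _ ⟨θ, -, rfl⟩
        exact norm_nonneg _
      refine ⟨convex_univ, fun θ _ θ' _ s t hs ht hst => ?_⟩
      simp only [← hT]
      refine (Real.rpow_le_rpow (norm_nonneg _) (h1.2 (mem_univ θ) (mem_univ θ') hs ht hst)
        (by linarith)).trans ?_
      exact (convexOn_rpow hp).2 (mem_Ici.mpr (norm_nonneg (T θ)))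
        (mem_Ici.mpr (norm_nonneg (T θ'))) hs ht hst
    refine ⟨convex_univ, fun θ hθ θ' hθ' s t hs ht hst => ?_⟩
    simp only [hΦ, Finset.smul_sum, ← Finset.sum_add_distrib]
    exact Finset.sum_le_sum fun ω _ => (key ω).2 hθ hθ' hs ht hst
  -- Where `b i = 0` the quotient is 0 by convention, which is harmless since then `c i = 0`.
  set θ : Fin N → ℝ := fun i => c i / b i with hθ
  have hθmem : θ ∈ convexHull ℝ (univ.pi fun _ : Fin N => ({-1, 1} : Set ℝ)) := by
    rw [convexHull_pi]
    intro i _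
    rw [convexHull_pair, segment_eq_Icc (by norm_num)]
    rw [mem_Icc, ← abs_le, hθ, abs_div]
    exact div_le_one_of_le₀ (hcb i) (abs_nonneg _)
  obtain ⟨σ, hσ, hle⟩ := hconv.exists_ge_of_mem_convexHull (subset_univ _) hθmem
  have e1 : Φ θ = ∑ ω : Fin N → Bool, ‖∑ i, (boolSign (ω i) * c i) • y i‖ ^ p := by
    refine Finset.sum_congr rfl fun ω _ => ?_
    congr 2
    refine Finset.sum_congr rfl fun i _ => ?_
    congr 1
    by_cases h0 : b i = 0
    · have : c i = 0 := by
        have := hcb i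
        rw [h0, abs_zero] at this
        exact abs_nonpos_iff.mp this
      simp [h0, this]
    · simp only [hθ]
      field_simp
  have e2 : Φ σ = ∑ ω : Fin N → Bool, ‖∑ i, (boolSign (ω i) * b i) • y i‖ ^ p := by
    let e : (Fin N → Bool) → (Fin N → Bool) := fun ω i => if σ i = 1 then ω i else !ω i
    have he : Function.Involutive e := by
      intro ω
      funext i
      by_cases h : σ i = 1 <;> simp [e, h]
    refine Fintype.sum_equiv he.toPerm _ _ fun ω => ?_
    congr 2
    refine Finset.sum_congr rfl fun i _ => ?_
    congr 1
    have : σ i = -1 ∨ σ i = 1 := by simpa using hσ i (mem_univ i)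
    rcases this with h | h
    · have h1 : ¬ ((-1 : ℝ) = 1) := by norm_num
      simp only [Function.Involutive.coe_toPerm, e, h, if_neg h1, boolSign_not]
      ring
    · simp [e, h]
  rw [← e1, ← e2]
  exact hle

end Contraction

/-! ## Enlarging a filtration by random signs -/

section Revealed

variable {X : Type u} {N : ℕ}

/-- The events of `X × {±1}^N` that depend only on the first `c` signs and have all their sections
in `m`. -/
@[reducible] def revealed (m : MeasurableSpace X) (N c : ℕ) : MeasurableSpace (X × (Fin N → Bool)) where
  MeasurableSet' B := (∀ ω, MeasurableSet[m] {t | (t, ω) ∈ B}) ∧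
    ∀ t ω, ∀ i : Fin N, c ≤ i → ((t, flipSign i ω) ∈ B ↔ (t, ω) ∈ B)
  measurableSet_empty := ⟨fun ω => by simp, by simp⟩
  measurableSet_compl B hB := ⟨fun ω => (hB.1 ω).compl, fun t ω i hi => not_congr (hB.2 t ω i hi)⟩
  measurableSet_iUnion f hf := by
    refine ⟨fun ω => ?_, fun t ω i hi => ?_⟩
    · have : {t | (t, ω) ∈ ⋃ n, f n} = ⋃ n, {t | (t, ω) ∈ f n} := by
        ext t
        simp
      rw [this]
      exact MeasurableSet.iUnion fun n => (hf n).1 ω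
    · simp only [mem_iUnion]
      exact exists_congr fun n => (hf n).2 t ω i hi

theorem revealed_mono {m m' : MeasurableSpace X} {c c' : ℕ} (hm : m ≤ m') (hc : c ≤ c') :
    revealed m N c ≤ revealed m' N c' :=
  fun _ hB => ⟨fun ω => hm _ (hB.1 ω), fun t ω i hi => hB.2 t ω i (hc.trans hi)⟩

theorem revealed_le {m : MeasurableSpace X} [mX : MeasurableSpace X] {c : ℕ} (hm : m ≤ mX) :
    revealed m N c ≤ Prod.instMeasurableSpace := by
  intro B hB
  have : B = ⋃ ω : Fin N → Bool, {t | (t, ω) ∈ B} ×ˢ {ω} := by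
    ext ⟨t, ω⟩
    simp
  rw [this]
  exact MeasurableSet.iUnion fun ω => (hm _ (hB.1 ω)).prod (measurableSet_singleton ω)

theorem measurable_fst_revealed {m : MeasurableSpace X} {c : ℕ} :
    @Measurable _ _ (revealed m N c) m (Prod.fst : X × (Fin N → Bool) → X) :=
  fun _ hs => ⟨fun _ => hs, fun _ _ _ _ => Iff.rfl⟩

theorem measurable_sign_revealed {m : MeasurableSpace X} {c : ℕ} {j : Fin N} (hj : (j : ℕ) < c) :
    @Measurable _ _ (revealed m N c) _
      (fun z : X × (Fin N → Bool) => boolSign (z.2 j)) := by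
  have h : @Measurable _ _ (revealed m N c) _ (fun z : X × (Fin N → Bool) => z.2 j) := by
    intro s _
    refine ⟨fun ω => MeasurableSet.const (ω j ∈ s), fun t ω i hi => ?_⟩
    have hne : j ≠ i := by
      rintro rfl
      omega
    simp [flipSign_of_ne hne]
  exact (measurable_of_countable boolSign).comp h

variable {E : Type v} [NormedAddCommGroup E] [NormedSpace ℝ E]

theorem setIntegral_prod_signMeasure [CompleteSpace E] [MeasurableSpace X] {ν : Measure X} [IsFiniteMeasure ν]
    {F : X × (Fin N → Bool) → E} (hF : Integrable F (ν.prod (signMeasure N)))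
    {B : Set (X × (Fin N → Bool))} (hB : MeasurableSet B) :
    ∫ z in B, F z ∂(ν.prod (signMeasure N)) = (Fintype.card (Fin N → Bool) : ℝ)⁻¹ •
      ∑ ω, ∫ t in {t | (t, ω) ∈ B}, F (t, ω) ∂ν := by
  rw [← integral_indicator hB, integral_prod_symm _ (hF.indicator hB), integral_signMeasure]
  congr 1
  refine Finset.sum_congr rfl fun ω _ => ?_
  have hBω : MeasurableSet {t | (t, ω) ∈ B} := measurable_prodMk_right hB
  rw [← integral_indicator hBω]
  rfl

theorem integrable_sign_smul [MeasurableSpace X] {ν : Measure X} [IsFiniteMeasure ν] {f : X → E} (hf : Integrable f ν)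
    (j : Fin N) : Integrable (fun z : X × (Fin N → Bool) => boolSign (z.2 j) • f z.1)
      (ν.prod (signMeasure N)) := by
  have h1 : Integrable (fun z : X × (Fin N → Bool) => f z.1) (ν.prod (signMeasure N)) :=
    hf.comp_fst _
  refine h1.bdd_smul 1 ?_ (Eventually.of_forall fun z => ?_)
  · exact ((measurable_of_countable fun ω : Fin N → Bool => boolSign (ω j)).comp
      measurable_snd).aestronglyMeasurable
  · rw [Real.norm_eq_abs, abs_boolSign]

variable [CompleteSpace E]

/-- A sign that is already revealed is measurable and factors out; on each section of an event only
the conditioning on `m` is left. -/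
theorem condExp_revealed_of_lt {m : MeasurableSpace X} [mX : MeasurableSpace X] (hm : m ≤ mX) {c : ℕ} {ν : Measure X}
    [IsFiniteMeasure ν] {f : X → E} (hf : Integrable f ν) {j : Fin N} (hj : (j : ℕ) < c) :
    (ν.prod (signMeasure N))[fun z => boolSign (z.2 j) • f z.1 | revealed m N c]
      =ᵐ[ν.prod (signMeasure N)] fun z => boolSign (z.2 j) • (ν[f | m]) z.1 := by
  symm
  refine ae_eq_condExp_of_forall_setIntegral_eq (revealed_le hm) (integrable_sign_smul hf j)
    (fun s _ _ => (integrable_sign_smul (f := ν[f | m]) integrable_condExp j).integrableOn) ?_ ?_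
  · intro B hB _
    rw [setIntegral_prod_signMeasure (integrable_sign_smul (f := ν[f | m]) integrable_condExp j)
      (revealed_le hm _ hB), setIntegral_prod_signMeasure (integrable_sign_smul hf j)
      (revealed_le hm _ hB)]
    congr 1
    refine Finset.sum_congr rfl fun ω _ => ?_
    simp only
    rw [integral_smul, integral_smul, setIntegral_condExp hm hf (hB.1 ω)]
  · refine StronglyMeasurable.aestronglyMeasurable ?_
    exact (measurable_sign_revealed hj).stronglyMeasurable.smul
      (stronglyMeasurable_condExp.comp_measurable measurable_fst_revealed)

/-- Flipping the unrevealed sign `j` preserves every event of the σ-algebra and negates the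
integrand, so all the integrals vanish. -/
theorem condExp_revealed_of_le {m : MeasurableSpace X} [mX : MeasurableSpace X] (hm : m ≤ mX) {c : ℕ} {ν : Measure X}
    [IsFiniteMeasure ν] {f : X → E} (hf : Integrable f ν) {j : Fin N} (hj : c ≤ (j : ℕ)) :
    (ν.prod (signMeasure N))[fun z => boolSign (z.2 j) • f z.1 | revealed m N c]
      =ᵐ[ν.prod (signMeasure N)] fun _ => 0 := by
  symm
  refine ae_eq_condExp_of_forall_setIntegral_eq (revealed_le hm) (integrable_sign_smul hf j)
    (fun s _ _ => (integrable_zero _ _ _).integrableOn) ?_ ?_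
  · intro B hB _
    rw [setIntegral_prod_signMeasure (integrable_sign_smul hf j) (revealed_le hm _ hB)]
    set I : (Fin N → Bool) → E := fun ω => ∫ t in {t | (t, ω) ∈ B}, boolSign (ω j) • f t ∂ν
    have hflip : ∀ ω, I (flipSign j ω) = -I ω := by
      intro ω
      have hs : {t | (t, flipSign j ω) ∈ B} = {t | (t, ω) ∈ B} := by
        ext t
        exact hB.2 t ω j hj
      simp only [I, hs, flipSign_same, boolSign_not, neg_smul, integral_neg]
    have hsum : ∑ ω, I ω = -∑ ω, I ω := by
      calc ∑ ω, I ω = ∑ ω, I (flipSign j ω) :=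
            (Fintype.sum_equiv (flipSign_involutive j).toPerm _ _ fun ω => rfl).symm
        _ = -∑ ω, I ω := by simp [hflip]
    have h0 : ∑ ω, I ω = 0 := by
      have h2 : (2 : ℝ) • ∑ ω, I ω = 0 := by
        rw [two_smul]
        exact add_eq_zero_iff_eq_neg.mpr hsum
      exact (smul_eq_zero.mp h2).resolve_left two_ne_zero
    simp [I, h0]
  · exact aestronglyMeasurable_const

end Revealed

/-! ## Filtrations adapted to a nested family -/

section Nested

variable {X : Type u} [mX : MeasurableSpace X] {N : ℕ}

/-- The measurable sets that do not split any of the sets `A j`, `j ≥ k`. -/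
@[reducible] def unsplit (A : Fin N → Set X) (k : ℕ) : MeasurableSpace X where
  MeasurableSet' B := MeasurableSet[mX] B ∧ ∀ j : Fin N, k ≤ j → A j ⊆ B ∨ Disjoint (A j) B
  measurableSet_empty := ⟨MeasurableSet.empty, fun j _ => Or.inr (disjoint_empty _)⟩
  measurableSet_compl B hB := ⟨hB.1.compl, fun j hj => (hB.2 j hj).symm.imp
    (fun h => subset_compl_iff_disjoint_right.mpr h) (fun h => disjoint_compl_right_iff_subset.mpr h)⟩
  measurableSet_iUnion f hf := by
    refine ⟨MeasurableSet.iUnion fun n => (hf n).1, fun j hj => ?_⟩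
    by_cases h : ∃ n, A j ⊆ f n
    · obtain ⟨n, hn⟩ := h
      exact Or.inl (hn.trans (subset_iUnion f n))
    · push Not at h
      exact Or.inr (disjoint_iUnion_right.mpr fun n => ((hf n).2 j hj).resolve_left (h n))

theorem unsplit_le (A : Fin N → Set X) (k : ℕ) : unsplit A k ≤ mX := fun _ hB => hB.1

theorem unsplit_mono (A : Fin N → Set X) : Monotone (unsplit A) :=
  fun _ _ hk _ hB => ⟨hB.1, fun j hj => hB.2 j (hk.trans hj)⟩

theorem unsplit_eq_of_le (A : Fin N → Set X) {k : ℕ} (hk : N ≤ k) : unsplit A k = mX := by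
  refine le_antisymm (unsplit_le A k) fun B hB => ⟨hB, fun j hj => ?_⟩
  have := j.2
  omega

variable {E : Type v} [NormedAddCommGroup E] [NormedSpace ℝ E] [CompleteSpace E]

/-- Nestedness with the later sets puts `A k` into the σ-algebra, and no member of the σ-algebra
splits it. So `A k` is an atom, and conditioning a function supported there is averaging over `A k`.
-/
theorem condExp_unsplit {A : Fin N → Set X} (hA : ∀ j, MeasurableSet (A j))
    (hnest : ∀ j k, j ≤ k → A k ⊆ A j ∨ Disjoint (A k) (A j)) {ν : Measure X} [IsFiniteMeasure ν]
    {k : Fin N} (hk : ν (A k) ≠ 0) {f : X → E} (hf : Integrable f ν)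
    (hsupp : ∀ t ∉ A k, f t = 0) :
    ν[f | unsplit A k] =ᵐ[ν] (A k).indicator fun _ => (ν.real (A k))⁻¹ • ∫ t, f t ∂ν := by
  symm
  have hAk : MeasurableSet[unsplit A k] (A k) := ⟨hA k, fun j hj => hnest k j hj⟩
  refine ae_eq_condExp_of_forall_setIntegral_eq (unsplit_le A k) hf
    (fun s _ _ => ((integrable_const _).indicator (hA k)).integrableOn) ?_ ?_
  · intro B hB _
    rw [setIntegral_indicator (hA k), setIntegral_const]
    rcases hB.2 k le_rfl with h | h
    · rw [inter_eq_right.mpr h, smul_smul, mul_inv_cancel₀, one_smul]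
      · symm
        exact setIntegral_eq_integral_of_forall_compl_eq_zero fun t ht =>
          hsupp t fun h' => ht (h h')
      · exact (measureReal_ne_zero_iff (measure_ne_top _ _)).mpr hk
    · rw [inter_comm, h.inter_eq]
      simp only [measureReal_empty, zero_smul]
      symm
      refine setIntegral_eq_zero_of_forall_eq_zero fun t ht => hsupp t fun h' => ?_
      exact (Set.disjoint_left.mp h h' ht)
  · exact (stronglyMeasurable_const.indicator hAk).aestronglyMeasurable

end Nested

/-! ## Consequences of the UMD property -/

section UMD

variable {E : Type v} [NormedAddCommGroup E] [NormedSpace ℝ E] [CompleteSpace E]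

/-- `C` is a UMD constant of `E` for the exponent `p`. -/
def HasUMDConstant (E : Type v) [NormedAddCommGroup E] [NormedSpace ℝ E] [CompleteSpace E]
    (p : ℝ≥0∞) (C : ℝ≥0) : Prop :=
  ∀ (Ω : Type u) (mΩ : MeasurableSpace Ω) (ν : Measure Ω) (_ : IsProbabilityMeasure ν)
    (ℱ : Filtration ℕ mΩ) (f : ℕ → Ω → E), Martingale f ℱ ν → (∀ n, MemLp (f n) p ν) →
    ∀ ε : ℕ → ℝ, (∀ n, ε n = 1 ∨ ε n = -1) → ∀ N : ℕ,
      eLpNorm (fun ω => ∑ n ∈ Finset.range N, ε n • (f (n + 1) ω - f n ω)) p ν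
        ≤ C * eLpNorm (fun ω => f N ω - f 0 ω) p ν

/-- Martingale differences (with an arbitrary first one) are unconditional in `L^p_E`. -/
theorem HasUMDConstant.eLpNorm_sign_sum_le {p : ℝ≥0∞} {C : ℝ≥0}
    (hC : HasUMDConstant.{u, v} E p C) (hp : 1 ≤ p) {Ω : Type u} [MeasurableSpace Ω]
    {ν : Measure Ω} [IsProbabilityMeasure ν] {d : ℕ → Ω → ℝ} (hdm : ∀ n, Measurable (d n))
    (hd : ∀ n, MemLp (d n) p ν)
    (hmds : ∀ n, ∀ A : Set Ω,
      MeasurableSet[⨆ j ≤ n, MeasurableSpace.comap (d j) inferInstance] A →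
        ∫ t in A, d (n + 1) t ∂ν = 0)
    (x : ℕ → E) {ε : ℕ → ℝ} (hε : ∀ n, ε n = 1 ∨ ε n = -1) (N : ℕ) :
    eLpNorm (fun t => ∑ j ∈ Finset.range (N + 1), (ε j * d j t) • x j) p ν ≤
      (1 + 2 * C) * eLpNorm (fun t => ∑ j ∈ Finset.range (N + 1), d j t • x j) p ν := by
  set f : ℕ → Ω → E := fun n t => ∑ j ∈ Finset.range (n + 1), d j t • x j with hfdef
  let ℱ : Filtration ℕ _ := Filtration.natural d fun n => (hdm n).stronglyMeasurable
  have hadd : ∀ j n, j ≤ n → Measurable[ℱ n] (d j) := fun j n hj =>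
    Measurable.of_comap_le (le_iSup₂_of_le j hj le_rfl)
  have hLp1 : ∀ j, MemLp (fun t => d j t • x j) p ν := fun j =>
    ((ContinuousLinearMap.id ℝ ℝ).smulRight (x j)).comp_memLp' (hd j)
  have hLp : ∀ n, MemLp (f n) p ν := fun n => memLp_finsetSum _ fun j _ => hLp1 j
  have hstep : ∀ n t, f (n + 1) t - f n t = d (n + 1) t • x (n + 1) := fun n t => by
    simp only [hfdef, Finset.sum_range_succ _ (n + 1), add_sub_cancel_left]
  have hadapt : StronglyAdapted ℱ f := fun n =>
    Finset.stronglyMeasurable_fun_sum _ fun j hj =>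
      (hadd j n (by simpa [Nat.lt_succ_iff] using hj)).stronglyMeasurable.smul_const _
  have hmart : Martingale f ℱ ν := by
    refine martingale_of_setIntegral_eq_succ hadapt (fun n => (hLp n).integrable hp) ?_
    intro n A hA
    have hA' := ℱ.le n A hA
    have h1 : ∫ t in A, (f (n + 1) t - f n t) ∂ν = 0 := by
      simp only [hstep]
      rw [integral_smul_const, hmds n A hA, zero_smul]
    rw [integral_sub ((hLp _).integrable hp).integrableOn ((hLp _).integrable hp).integrableOn]
      at h1
    exact (sub_eq_zero.mp h1).symm
  -- UMD controls only `f N - f 0`. The arbitrary first term is a conditional expectation of `f N`,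
  -- hence no larger; this turns `C` into `1 + 2C`.
  have hf0 : eLpNorm (f 0) p ν ≤ eLpNorm (f N) p ν := by
    rw [← eLpNorm_congr_ae (hmart.condExp_ae_eq (Nat.zero_le N))]
    exact eLpNorm_condExp_le_eLpNorm _ hp
  have hsplit : (fun t => ∑ j ∈ Finset.range (N + 1), (ε j * d j t) • x j) =
      (fun t => ∑ n ∈ Finset.range N, ε (n + 1) • (f (n + 1) t - f n t)) + ε 0 • f 0 := by
    funext t
    rw [Finset.sum_range_succ']
    simp only [hstep, smul_smul, Pi.add_apply, Pi.smul_apply]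
    simp [hfdef, smul_smul]
  have hε0 : eLpNorm (ε 0 • f 0) p ν = eLpNorm (f 0) p ν := by
    rcases hε 0 with h | h <;> simp [h]
  have hm : AEStronglyMeasurable
      (fun t => ∑ n ∈ Finset.range N, ε (n + 1) • (f (n + 1) t - f n t)) ν :=
    (memLp_finsetSum _ fun n _ =>
      ((hLp (n + 1)).sub (hLp n)).const_smul (ε (n + 1))).aestronglyMeasurable
  calc eLpNorm (fun t => ∑ j ∈ Finset.range (N + 1), (ε j * d j t) • x j) p ν
      ≤ eLpNorm (fun t => ∑ n ∈ Finset.range N, ε (n + 1) • (f (n + 1) t - f n t)) p ν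
          + eLpNorm (ε 0 • f 0) p ν := by
        rw [hsplit]
        exact eLpNorm_add_le hm ((hLp 0).const_smul _).aestronglyMeasurable hp
    _ ≤ C * eLpNorm (fun t => f N t - f 0 t) p ν + eLpNorm (f N) p ν := by
        rw [hε0]
        exact add_le_add (hC Ω _ ν inferInstance ℱ f hmart hLp _ (fun n => hε (n + 1)) N) hf0
    _ ≤ C * (eLpNorm (f N) p ν + eLpNorm (f N) p ν) + eLpNorm (f N) p ν := by
        gcongr
        refine (eLpNorm_sub_le (hLp N).aestronglyMeasurable (hLp 0).aestronglyMeasurable hp).trans ?_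
        gcongr
    _ = (1 + 2 * C) * eLpNorm (f N) p ν := by ring

/-- Used to extract every second martingale difference: UMD bounds the sum with alternating signs,
and averaging it with the unsigned sum cancels the odd terms. -/
theorem sum_even_eq_half_sum_add_alternating {V : Type*} [AddCommGroup V] [Module ℝ V]
    (a : ℕ → V) (N : ℕ) : ∑ k ∈ Finset.range N, a (2 * k) = (2 : ℝ)⁻¹ •
      (∑ n ∈ Finset.range (2 * N), a n + ∑ n ∈ Finset.range (2 * N), ((-1 : ℝ) ^ n) • a n) := by
  induction N with
  | zero => simp
  | succ N ih =>
    rw [Finset.sum_range_succ, ih, show 2 * (N + 1) = 2 * N + 1 + 1 by ring]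
    simp only [Finset.sum_range_succ _ (2 * N + 1), Finset.sum_range_succ _ (2 * N)]
    rw [pow_succ, pow_mul]
    simp only [even_two, Even.neg_pow, one_pow, one_mul]
    module

/-- The Bourgain–Stein inequality for the averages over a nested family of sets. -/
theorem HasUMDConstant.eLpNorm_sign_average_le {p : ℝ≥0∞} {C : ℝ≥0}
    (hC : HasUMDConstant.{u, v} E p C) (hp : 1 ≤ p) {X : Type u} [mX : MeasurableSpace X]
    {ν : Measure X} [IsProbabilityMeasure ν] {N : ℕ} {A : Fin N → Set X}
    (hA : ∀ j, MeasurableSet (A j)) (hnest : ∀ j k, j ≤ k → A k ⊆ A j ∨ Disjoint (A k) (A j))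
    (hpos : ∀ k, ν (A k) ≠ 0) {f : Fin N → X → E} (hf : ∀ k, MemLp (f k) p ν)
    (hsupp : ∀ k, ∀ t ∉ A k, f k t = 0) :
    eLpNorm (fun z : X × (Fin N → Bool) => ∑ k, boolSign (z.2 k) •
        (A k).indicator (fun _ => (ν.real (A k))⁻¹ • ∫ t, f k t ∂ν) z.1) p
        (ν.prod (signMeasure N)) ≤
      (1 + C) * eLpNorm (fun z : X × (Fin N → Bool) => ∑ k, boolSign (z.2 k) • f k z.1) p
        (ν.prod (signMeasure N)) := by
  set π := ν.prod (signMeasure N)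
  have hint : ∀ k, Integrable (f k) ν := fun k => (hf k).integrable hp
  -- The two coordinates are refined alternately: the step from `2k` to `2k + 1` reveals the sign
  -- `k` while the σ-algebra on `X` stays `unsplit A k`; the next step passes to `unsplit A (k +
  -- 1)`. The differences of the first kind are exactly the signed averages.
  let 𝒢 : Filtration ℕ (Prod.instMeasurableSpace : MeasurableSpace (X × (Fin N → Bool))) :=
    { seq := fun n => revealed (unsplit A (n / 2)) N ((n + 1) / 2)
      mono' := fun a b hab => revealed_mono (unsplit_mono A (by omega)) (by omega)
      le' := fun n => revealed_le (unsplit_le A _) }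
  set r : Fin N → X × (Fin N → Bool) → E := fun k z => boolSign (z.2 k) • f k z.1 with hr
  set F : X × (Fin N → Bool) → E := ∑ k, r k with hF
  have hrint : ∀ k, Integrable (r k) π := fun k => integrable_sign_smul (hint k) k
  have hrLp : ∀ k, MemLp (r k) p π := fun k => by
    refine ((hf k).comp_fst (signMeasure N)).of_le (hrint k).aestronglyMeasurable
      (Eventually.of_forall fun z => ?_)
    simp [hr, norm_smul, abs_boolSign]
  have hFLp : MemLp F p π := memLp_finsetSum' _ fun k _ => hrLp k
  have hcond : ∀ n, π[F | 𝒢 n] =ᵐ[π] ∑ k, π[r k | 𝒢 n] := fun n =>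
    condExp_finsetSum (fun k _ => hrint k) _
  have hlt : ∀ (n : ℕ) (k : Fin N), (k : ℕ) < (n + 1) / 2 → π[r k | 𝒢 n] =ᵐ[π]
      fun z => boolSign (z.2 k) • (ν[f k | unsplit A (n / 2)]) z.1 := fun n k hk =>
    condExp_revealed_of_lt (unsplit_le A _) (hint k) hk
  have hge : ∀ (n : ℕ) (k : Fin N), (n + 1) / 2 ≤ (k : ℕ) → π[r k | 𝒢 n] =ᵐ[π] fun _ => 0 :=
    fun n k hk => condExp_revealed_of_le (unsplit_le A _) (hint k) hk
  -- No sign is known at time 0 and everything is known at time `2N`, so the martingale runs from 0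
  -- to `F` and no initial term has to be corrected.
  have hzero : π[F | 𝒢 0] =ᵐ[π] fun _ => 0 := by
    have h1 : ∀ᵐ z ∂π, ∀ k, (π[r k | 𝒢 0]) z = 0 :=
      ae_all_iff.mpr fun k => hge 0 k (by simp)
    filter_upwards [hcond 0, h1] with z hz hz1
    rw [hz, Finset.sum_apply]
    exact Finset.sum_eq_zero fun k _ => hz1 k
  have hlast : π[F | 𝒢 (2 * N)] =ᵐ[π] F := by
    have h1 : ∀ᵐ z ∂π, ∀ k, (π[r k | 𝒢 (2 * N)]) z = r k z := by
      refine ae_all_iff.mpr fun k => ?_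
      have h2 := hlt (2 * N) k (by have := k.2; omega)
      rw [unsplit_eq_of_le A (by omega : N ≤ 2 * N / 2)] at h2
      have h3 : ∀ᵐ z ∂π, (ν[f k | mX]) z.1 = f k z.1 := Measure.quasiMeasurePreserving_fst.ae
        (condExp_of_aestronglyMeasurable' le_rfl (hint k).aestronglyMeasurable (hint k))
      filter_upwards [h2, h3] with z hz2 hz3
      rw [hz2, hz3]
    filter_upwards [hcond (2 * N), h1] with z hz hz1
    rw [hz, hF, Finset.sum_apply, Finset.sum_apply]
    exact Finset.sum_congr rfl fun k _ => hz1 k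
  have hdiff : ∀ k : Fin N, (fun z => (π[F | 𝒢 (2 * k + 1)]) z - (π[F | 𝒢 (2 * k)]) z) =ᵐ[π]
      fun z => boolSign (z.2 k) •
        (A k).indicator (fun _ => (ν.real (A k))⁻¹ • ∫ t, f k t ∂ν) z.1 := by
    intro k
    have hdivs : (2 * (k : ℕ) + 1) / 2 = 2 * (k : ℕ) / 2 := by omega
    -- Revealing the sign `k` leaves the other terms alone: those with smaller index see the same
    -- σ-algebra on `X`, those with larger index still have conditional expectation zero.
    have h1 : ∀ᵐ z ∂π, ∀ j, j ≠ k →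
        (π[r j | 𝒢 (2 * k + 1)]) z = (π[r j | 𝒢 (2 * k)]) z := by
      refine ae_all_iff.mpr fun j => ?_
      by_cases hjk : j = k
      · simp [hjk]
      have hne : (j : ℕ) ≠ k := fun h => hjk (Fin.ext h)
      rcases lt_or_gt_of_ne hne with h | h
      · have h1 := hlt (2 * k + 1) j (by omega)
        have h2 := hlt (2 * k) j (by omega)
        rw [hdivs] at h1
        filter_upwards [h1, h2] with z hz1 hz2 _
        rw [hz1, hz2]
      · filter_upwards [hge (2 * k + 1) j (by omega), hge (2 * k) j (by omega)] with z hz1 hz2 _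
        rw [hz1, hz2]
    have h2 := hlt (2 * k + 1) k (by omega)
    have h3 := hge (2 * k) k (by omega)
    have h4 := condExp_unsplit hA hnest (hpos k) (hint k) (hsupp k)
    have h5 : ∀ᵐ z ∂π, (ν[f k | unsplit A k]) z.1 =
        (A k).indicator (fun _ => (ν.real (A k))⁻¹ • ∫ t, f k t ∂ν) z.1 :=
      Measure.quasiMeasurePreserving_fst.ae h4
    have hdiv : (2 * (k : ℕ) + 1) / 2 = k := by omega
    rw [hdiv] at h2
    filter_upwards [hcond (2 * k + 1), hcond (2 * k), h1, h2, h3, h5] with z c1 c2 c3 c4 c5 c6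
    rw [c1, c2, Finset.sum_apply, Finset.sum_apply, ← Finset.sum_sub_distrib,
      Finset.sum_eq_single k (fun j _ hj => by rw [c3 j hj, sub_self]) (by simp), c4, c5, c6,
      sub_zero]
  have hmart := martingale_condExp F 𝒢 π
  have hmLp : ∀ n, MemLp (π[F | 𝒢 n]) p π := fun n => hFLp.condExp hp
  have hFnorm : eLpNorm (fun z => (π[F | 𝒢 (2 * N)]) z - (π[F | 𝒢 0]) z) p π = eLpNorm F p π := by
    refine eLpNorm_congr_ae ?_
    filter_upwards [hzero, hlast] with z h0 h1
    rw [h0, h1, sub_zero]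
  have humd : ∀ ε : ℕ → ℝ, (∀ n, ε n = 1 ∨ ε n = -1) →
      eLpNorm (fun z => ∑ n ∈ Finset.range (2 * N),
        ε n • ((π[F | 𝒢 (n + 1)]) z - (π[F | 𝒢 n]) z)) p π ≤ C * eLpNorm F p π := by
    intro ε hε
    rw [← hFnorm]
    exact hC _ _ π inferInstance 𝒢 _ hmart hmLp ε hε (2 * N)
  set D : ℕ → X × (Fin N → Bool) → E := fun n z => (π[F | 𝒢 (n + 1)]) z - (π[F | 𝒢 n]) z with hD
  have hDLp : ∀ n, MemLp (D n) p π := fun n => (hmLp (n + 1)).sub (hmLp n)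
  have hodd : ∀ z, ∑ k : Fin N, D (2 * k) z =
      (2 : ℝ)⁻¹ • (∑ n ∈ Finset.range (2 * N), D n z +
        ∑ n ∈ Finset.range (2 * N), ((-1 : ℝ) ^ n) • D n z) := by
    intro z
    rw [Fin.sum_univ_eq_sum_range (fun k => D (2 * k) z) N]
    exact sum_even_eq_half_sum_add_alternating (fun n => D n z) N
  have htel : ∀ z, ∑ n ∈ Finset.range (2 * N), D n z =
      (π[F | 𝒢 (2 * N)]) z - (π[F | 𝒢 0]) z := fun z =>
    Finset.sum_range_sub (fun n => (π[F | 𝒢 n]) z) (2 * N)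
  calc _ = eLpNorm (fun z => ∑ k : Fin N, D (2 * k) z) p π := by
        refine eLpNorm_congr_ae ?_
        have h1 : ∀ᵐ z ∂π, ∀ k : Fin N, D (2 * k) z = boolSign (z.2 k) •
            (A k).indicator (fun _ => (ν.real (A k))⁻¹ • ∫ t, f k t ∂ν) z.1 :=
          ae_all_iff.mpr fun k => hdiff k
        filter_upwards [h1] with z hz
        exact Finset.sum_congr rfl fun k _ => (hz k).symm
    -- The factor 1/2 of the averaging identity is simply bounded by 1.
    _ ≤ 1 * (eLpNorm F p π + C * eLpNorm F p π) := by
        simp only [hodd]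
        refine (eLpNorm_const_smul_le (c := (2 : ℝ)⁻¹) (f := fun z =>
          ∑ n ∈ Finset.range (2 * N), D n z +
            ∑ n ∈ Finset.range (2 * N), ((-1 : ℝ) ^ n) • D n z)).trans ?_
        refine mul_le_mul' ?_ ((eLpNorm_add_le ?_ ?_ hp).trans (add_le_add ?_ ?_))
        · rw [← ofReal_norm]
          refine ENNReal.ofReal_le_one.mpr ?_
          norm_num
        · exact (memLp_finsetSum _ fun n _ => hDLp n).aestronglyMeasurable
        · exact (memLp_finsetSum _ fun n _ =>
            (hDLp n).const_smul ((-1 : ℝ) ^ n)).aestronglyMeasurable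
        · simp only [htel]
          exact hFnorm.le
        · exact humd _ fun n => neg_one_pow_eq_or ℝ n
    _ = (1 + C) * eLpNorm F p π := by ring
    _ = _ := by
        congr 2
        funext z
        simp [hF, hr]

end UMD

/-! ## Norms on the product with the random signs -/

section Fibers

variable {X : Type u} [MeasurableSpace X] {E : Type v} [NormedAddCommGroup E] {N : ℕ}

/-- The `p`-th power of the norm on the product is the mean over `ω` of the `p`-th powers on the
fibres. This transfers the unconditionality estimates, which hold for each fixed choice of signs. -/
theorem eLpNorm_prod_le_of_forall_fiber {ν : Measure X} [IsFiniteMeasure ν] {p : ℝ≥0∞}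
    (hp0 : p ≠ 0) (hp : p ≠ ∞) {f g : X × (Fin N → Bool) → E} {K : ℝ≥0∞}
    (hf : AEStronglyMeasurable f (ν.prod (signMeasure N)))
    (hg : AEStronglyMeasurable g (ν.prod (signMeasure N)))
    (h : ∀ ω, eLpNorm (fun t => f (t, ω)) p ν ≤ K * eLpNorm (fun t => g (t, ω)) p ν) :
    eLpNorm f p (ν.prod (signMeasure N)) ≤ K * eLpNorm g p (ν.prod (signMeasure N)) := by
  have hp' : 0 < p.toReal := ENNReal.toReal_pos hp0 hp
  have key : ∀ F : X × (Fin N → Bool) → E, AEStronglyMeasurable F (ν.prod (signMeasure N)) →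
      eLpNorm F p (ν.prod (signMeasure N)) ^ p.toReal =
        (Fintype.card (Fin N → Bool) : ℝ≥0∞)⁻¹ *
          ∑ ω, eLpNorm (fun t => F (t, ω)) p ν ^ p.toReal := by
    intro F hF
    rw [eLpNorm_eq_lintegral_rpow_enorm_toReal hp0 hp, ← ENNReal.rpow_mul,
      one_div_mul_cancel hp'.ne', ENNReal.rpow_one,
      lintegral_prod_symm _ (hF.enorm.pow_const _), lintegral_signMeasure]
    congr 1
    refine Finset.sum_congr rfl fun ω _ => ?_
    rw [eLpNorm_eq_lintegral_rpow_enorm_toReal hp0 hp, ← ENNReal.rpow_mul,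
      one_div_mul_cancel hp'.ne', ENNReal.rpow_one]
  rw [← ENNReal.rpow_le_rpow_iff hp', ENNReal.mul_rpow_of_nonneg _ _ hp'.le, key f hf, key g hg,
    mul_left_comm, Finset.mul_sum _ _ (K ^ p.toReal)]
  refine mul_le_mul' le_rfl (Finset.sum_le_sum fun ω _ => ?_)
  rw [← ENNReal.mul_rpow_of_nonneg _ _ hp'.le]
  exact ENNReal.rpow_le_rpow (h ω) hp'.le

/-- Fubini in the other order: with `t` fixed, the sums over `ω` are the moments that the
contraction principle compares. -/
theorem eLpNorm_prod_mono_of_sum_sign {ν : Measure X} [IsFiniteMeasure ν] {p : ℝ≥0∞}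
    (hp0 : p ≠ 0) (hp : p ≠ ∞) {f g : X × (Fin N → Bool) → E}
    (hf : AEStronglyMeasurable f (ν.prod (signMeasure N)))
    (hg : AEStronglyMeasurable g (ν.prod (signMeasure N)))
    (h : ∀ᵐ t ∂ν, ∑ ω, ‖f (t, ω)‖ ^ p.toReal ≤ ∑ ω, ‖g (t, ω)‖ ^ p.toReal) :
    eLpNorm f p (ν.prod (signMeasure N)) ≤ eLpNorm g p (ν.prod (signMeasure N)) := by
  have hp' : 0 < p.toReal := ENNReal.toReal_pos hp0 hp
  rw [eLpNorm_eq_lintegral_rpow_enorm_toReal hp0 hp, eLpNorm_eq_lintegral_rpow_enorm_toReal hp0 hp,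
    lintegral_prod _ (hf.enorm.pow_const _), lintegral_prod _ (hg.enorm.pow_const _)]
  refine ENNReal.rpow_le_rpow (lintegral_mono_ae ?_) (by positivity)
  filter_upwards [h] with t ht
  rw [lintegral_signMeasure, lintegral_signMeasure]
  gcongr 1
  have conv : ∀ F : X × (Fin N → Bool) → E, ∑ ω, ‖F (t, ω)‖ₑ ^ p.toReal =
      ENNReal.ofReal (∑ ω, ‖F (t, ω)‖ ^ p.toReal) := by
    intro F
    rw [ENNReal.ofReal_sum_of_nonneg fun ω _ => by positivity]
    refine Finset.sum_congr rfl fun ω _ => ?_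
    rw [← ofReal_norm, ENNReal.ofReal_rpow_of_nonneg (norm_nonneg _) hp'.le]
  rw [conv, conv]
  exact ENNReal.ofReal_le_ofReal ht

end Fibers

/-! ## Unconditionality of martingale difference families -/

section MDS

variable {E : Type v} [NormedAddCommGroup E] [NormedSpace ℝ E]

/-- For functions living on `W`, conditioning on `W` only rescales integrals, so vanishing integrals
and ratios of integrals to measures are preserved. -/
theorem setIntegral_cond {X : Type u} [MeasurableSpace X] {μ : Measure X} {W A : Set X}
    (hA : MeasurableSet A) {f : X → E} (hf : ∀ t ∉ W, f t = 0) :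
    ∫ t in A, f t ∂μ[|W] = (μ.real W)⁻¹ • ∫ t in A, f t ∂μ := by
  rw [ProbabilityTheory.cond, Measure.restrict_smul, integral_smul_measure,
    Measure.restrict_restrict hA, ENNReal.toReal_inv, measureReal_def]
  congr 1
  exact (setIntegral_eq_of_subset_of_forall_sdiff_eq_zero hA inter_subset_left
    fun t ht => hf t fun h => ht.2 ⟨ht.1, h⟩).symm

variable [CompleteSpace E]

/-- A finite subfamily, sorted by the order of the differences, is again a martingale difference
sequence, since its past generates a smaller σ-algebra than the past in `I`. Padding by zeros makes
it infinite. -/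
theorem HasUMDConstant.eLpNorm_sign_sum_le_of_isMartingaleDifferenceFamily {p : ℝ≥0∞} {C : ℝ≥0}
    (hC : HasUMDConstant.{u, v} E p C) (hp : 1 ≤ p) {X ι : Type u} [MeasurableSpace X]
    {μ : Measure X} {I : Set ι} {h : ι → X → ℝ} (hmds : IsMartingaleDifferenceFamily μ I h)
    (hmeas : ∀ i, Measurable (h i)) {W : Set X} (hW0 : μ W ≠ 0)
    (hWtop : μ W ≠ ∞) {N : ℕ} {P : Fin N → ι} (hP : Function.Injective P) (hPI : ∀ k, P k ∈ I)
    (hsupp : ∀ k, ∀ t ∉ W, h (P k) t = 0) (hLp : ∀ k, MemLp (h (P k)) p μ[|W])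
    (x : Fin N → E) {ε : Fin N → ℝ} (hε : ∀ k, ε k = 1 ∨ ε k = -1) :
    eLpNorm (fun t => ∑ k, (ε k * h (P k) t) • x k) p μ[|W] ≤
      (1 + 2 * C) * eLpNorm (fun t => ∑ k, h (P k) t • x k) p μ[|W] := by
  have : IsProbabilityMeasure μ[|W] := cond_isProbabilityMeasure_of_finite hW0 hWtop
  obtain ⟨_, hmds⟩ := hmds
  rcases N with _ | M
  · simp
  let σ := Tuple.sort P
  have hσ : StrictMono (P ∘ σ) := (Tuple.monotone_sort P).strictMono_of_injective
    (hP.comp σ.injective)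
  let d : ℕ → X → ℝ := fun n => if hn : n < M + 1 then h (P (σ ⟨n, hn⟩)) else 0
  have hd : ∀ k : Fin (M + 1), d k = h (P (σ k)) := fun k => dif_pos k.2
  have hdm : ∀ n, Measurable (d n) := fun n => by
    by_cases hn : n < M + 1
    · simpa only [d, dif_pos hn] using hmeas _
    · simpa only [d, dif_neg hn] using measurable_zero
  have hdLp : ∀ n, MemLp (d n) p μ[|W] := fun n => by
    by_cases hn : n < M + 1
    · simpa only [d, dif_pos hn] using hLp _
    · simpa only [d, dif_neg hn] using MemLp.zero
  have hdmds : ∀ n, ∀ A : Set X,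
      MeasurableSet[⨆ j ≤ n, MeasurableSpace.comap (d j) inferInstance] A →
        ∫ t in A, d (n + 1) t ∂μ[|W] = 0 := by
    intro n A hA
    have hA' : MeasurableSet A :=
      (iSup₂_le fun j _ => (hdm j).comap_le :
        (⨆ j ≤ n, MeasurableSpace.comap (d j) inferInstance) ≤ _) _ hA
    by_cases hn : n + 1 < M + 1
    · simp only [d, dif_pos hn]
      rw [setIntegral_cond hA' (hsupp _)]
      -- The smallest chosen index is a predecessor, so the exemption of a very first difference
      -- does not apply.
      rw [hmds (P (σ ⟨n + 1, hn⟩)) (hPI _) ⟨P (σ 0), hPI _, hσ (Fin.mk_lt_mk.mpr n.succ_pos)⟩ A ?_,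
        smul_zero]
      refine (iSup₂_le fun j hj => ?_ : (⨆ j ≤ n, MeasurableSpace.comap (d j) inferInstance) ≤ _)
        _ hA
      have hj' : j < M + 1 := by omega
      simp only [d, dif_pos hj']
      exact le_iSup₂_of_le (P (σ ⟨j, hj'⟩)) ⟨hPI _, hσ (Fin.mk_lt_mk.mpr (by omega))⟩ le_rfl
    · simp only [d, dif_neg hn, Pi.zero_apply, integral_zero]
  let x' : ℕ → E := fun n => if hn : n < M + 1 then x (σ ⟨n, hn⟩) else 0
  let ε' : ℕ → ℝ := fun n => if hn : n < M + 1 then ε (σ ⟨n, hn⟩) else 1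
  have hε' : ∀ n, ε' n = 1 ∨ ε' n = -1 := fun n => by
    by_cases hn : n < M + 1
    · simpa only [ε', dif_pos hn] using hε _
    · exact Or.inl (dif_neg hn)
  have hx'k : ∀ k : Fin (M + 1), x' k = x (σ k) := fun k => dif_pos k.2
  have hε'k : ∀ k : Fin (M + 1), ε' k = ε (σ k) := fun k => dif_pos k.2
  have key := hC.eLpNorm_sign_sum_le hp hdm hdLp hdmds x' hε' M
  have e1 : ∀ t, ∑ j ∈ Finset.range (M + 1), (ε' j * d j t) • x' j =
      ∑ k, (ε k * h (P k) t) • x k := fun t => by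
    rw [Finset.sum_range, ← Equiv.sum_comp σ fun k => (ε k * h (P k) t) • x k]
    simp only [hd, hx'k, hε'k]
  have e2 : ∀ t, ∑ j ∈ Finset.range (M + 1), d j t • x' j = ∑ k, h (P k) t • x k := fun t => by
    rw [Finset.sum_range, ← Equiv.sum_comp σ fun k => h (P k) t • x k]
    simp only [hd, hx'k]
  simpa only [e1, e2] using key

end MDS

/-! ## Comparison of two unconditional families -/

section Comparison

variable {E : Type v} [NormedAddCommGroup E] [NormedSpace ℝ E] [CompleteSpace E]

/-- If `g k` is dominated by `c` times the average of `|h k|` over `A k`, for a nested family of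
sets `A k`, then `∑ h k x k ↦ ∑ g k x k` is bounded as soon as both families are unconditional. -/
theorem HasUMDConstant.eLpNorm_sum_le_of_dominated {p : ℝ≥0∞} {C : ℝ≥0}
    (hC : HasUMDConstant.{u, v} E p C) (hp : 1 ≤ p) (hptop : p ≠ ∞) {X : Type u}
    [MeasurableSpace X] {ν : Measure X} [IsProbabilityMeasure ν] {N : ℕ} {A : Fin N → Set X}
    (hA : ∀ j, MeasurableSet (A j)) (hnest : ∀ j k, j ≤ k → A k ⊆ A j ∨ Disjoint (A k) (A j))
    (hpos : ∀ k, ν (A k) ≠ 0) {g h : Fin N → X → ℝ} (hg : ∀ k, MemLp (g k) p ν)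
    (hh : ∀ k, MemLp (h k) p ν) (hsupp : ∀ k, ∀ t ∉ A k, h k t = 0) {c : ℝ} (hc : 0 ≤ c)
    (hdom : ∀ k, ∀ᵐ t ∂ν, |g k t| ≤
      c * (A k).indicator (fun _ => (ν.real (A k))⁻¹ * ∫ t, |h k t| ∂ν) t)
    (x : Fin N → E) {K : ℝ≥0∞}
    (hgu : ∀ ω : Fin N → Bool, eLpNorm (fun t => ∑ k, g k t • x k) p ν ≤
      K * eLpNorm (fun t => ∑ k, (boolSign (ω k) * g k t) • x k) p ν)
    (hhu : ∀ ω : Fin N → Bool, eLpNorm (fun t => ∑ k, (boolSign (ω k) * h k t) • x k) p ν ≤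
      K * eLpNorm (fun t => ∑ k, h k t • x k) p ν) :
    eLpNorm (fun t => ∑ k, g k t • x k) p ν ≤
      K * (ENNReal.ofReal c * ((1 + C) * (K * eLpNorm (fun t => ∑ k, h k t • x k) p ν))) := by
  have hp0 : p ≠ 0 := (zero_lt_one.trans_le hp).ne'
  have hp1 : 1 ≤ p.toReal := by
    simpa using ENNReal.toReal_mono hptop hp
  set a : Fin N → X → ℝ := fun k =>
    (A k).indicator (fun _ => (ν.real (A k))⁻¹ * ∫ t, |h k t| ∂ν) with ha
  set π := ν.prod (signMeasure N)
  have hsm : ∀ f : X → E, AEStronglyMeasurable f ν →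
      AEStronglyMeasurable (fun z : X × (Fin N → Bool) => f z.1) π := fun f hf => hf.comp_fst
  have hsgn : ∀ k : Fin N, AEStronglyMeasurable
      (fun z : X × (Fin N → Bool) => boolSign (z.2 k)) π := fun k =>
    ((measurable_of_countable fun ω : Fin N → Bool => boolSign (ω k)).comp
      measurable_snd).aestronglyMeasurable
  have hmeas : ∀ f : Fin N → X → ℝ, (∀ k, AEStronglyMeasurable (f k) ν) → AEStronglyMeasurable
      (fun z : X × (Fin N → Bool) => ∑ k, (boolSign (z.2 k) * f k z.1) • x k) π := by
    intro f hf
    refine Finset.aestronglyMeasurable_fun_sum _ fun k _ => ?_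
    exact ((hsgn k).mul (hf k).comp_fst).smul_const _
  have hgm := hmeas g fun k => (hg k).aestronglyMeasurable
  have hhm := hmeas h fun k => (hh k).aestronglyMeasurable
  have hhabs : ∀ k, MemLp (fun t => |h k t|) p ν := fun k => (hh k).abs
  have hham := hmeas (fun k t => |h k t|) fun k => (hhabs k).aestronglyMeasurable
  have ham' : ∀ k, AEStronglyMeasurable (a k) ν := fun k =>
    aestronglyMeasurable_const.indicator (hA k)
  have ham := hmeas a ham'
  have hcam := hmeas (fun k t => c * a k t) fun k => (ham' k).const_mul c
  have fst_eq : ∀ f : X → E, AEStronglyMeasurable f ν →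
      eLpNorm (fun z : X × (Fin N → Bool) => f z.1) p π = eLpNorm f p ν := fun f hf =>
    eLpNorm_comp_measurePreserving hf measurePreserving_fst
  have hgs : AEStronglyMeasurable (fun t => ∑ k, g k t • x k) ν :=
    Finset.aestronglyMeasurable_fun_sum _ fun k _ => (hg k).aestronglyMeasurable.smul_const _
  have hhs : AEStronglyMeasurable (fun t => ∑ k, h k t • x k) ν :=
    Finset.aestronglyMeasurable_fun_sum _ fun k _ => (hh k).aestronglyMeasurable.smul_const _
  have step1 : eLpNorm (fun t => ∑ k, g k t • x k) p ν ≤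
      K * eLpNorm (fun z : X × (Fin N → Bool) => ∑ k, (boolSign (z.2 k) * g k z.1) • x k) p π := by
    rw [← fst_eq _ hgs]
    exact eLpNorm_prod_le_of_forall_fiber hp0 hptop (hsm _ hgs) hgm hgu
  have step2 : eLpNorm (fun z : X × (Fin N → Bool) =>
        ∑ k, (boolSign (z.2 k) * g k z.1) • x k) p π ≤
      eLpNorm (fun z : X × (Fin N → Bool) =>
        ∑ k, (boolSign (z.2 k) * (c * a k z.1)) • x k) p π := by
    refine eLpNorm_prod_mono_of_sum_sign hp0 hptop hgm hcam ?_
    filter_upwards [ae_all_iff.mpr hdom] with t ht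
    exact sum_norm_rpow_sign_contraction hp1 x (fun k => c * a k t) (fun k => g k t)
      fun k => (ht k).trans (le_abs_self _)
  have step3 : eLpNorm (fun z : X × (Fin N → Bool) =>
        ∑ k, (boolSign (z.2 k) * (c * a k z.1)) • x k) p π ≤
      ENNReal.ofReal c * eLpNorm (fun z : X × (Fin N → Bool) =>
        ∑ k, (boolSign (z.2 k) * a k z.1) • x k) p π := by
    have : (fun z : X × (Fin N → Bool) => ∑ k, (boolSign (z.2 k) * (c * a k z.1)) • x k) =
        c • fun z : X × (Fin N → Bool) => ∑ k, (boolSign (z.2 k) * a k z.1) • x k := by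
      funext z
      simp only [Pi.smul_apply, Finset.smul_sum, smul_smul]
      refine Finset.sum_congr rfl fun k _ => ?_
      congr 1
      ring
    rw [this, eLpNorm_const_smul, Real.enorm_eq_ofReal hc]
  have step4 : eLpNorm (fun z : X × (Fin N → Bool) => ∑ k, (boolSign (z.2 k) * a k z.1) • x k) p π
      ≤ (1 + C) * eLpNorm (fun z : X × (Fin N → Bool) =>
        ∑ k, (boolSign (z.2 k) * |h k z.1|) • x k) p π := by
    -- Stein's inequality is applied to `|h k| x k`, not to `h k x k`, whose average may vanish by
    -- cancellation. The contraction principle removes the absolute values in the next step.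
    have := hC.eLpNorm_sign_average_le hp hA hnest hpos (f := fun k t => |h k t| • x k)
      (fun k => ((ContinuousLinearMap.id ℝ ℝ).smulRight (x k)).comp_memLp' (hhabs k))
      (fun k t ht => by simp [hsupp k t ht])
    simp only [smul_smul] at this
    refine le_trans (le_of_eq ?_) this
    congr 1
    funext z
    refine Finset.sum_congr rfl fun k _ => ?_
    by_cases hz : z.1 ∈ A k
    · simp only [ha, indicator_of_mem hz, integral_smul_const, smul_smul]
    · simp [ha, indicator_of_notMem hz]
  have step5 : eLpNorm (fun z : X × (Fin N → Bool) =>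
        ∑ k, (boolSign (z.2 k) * |h k z.1|) • x k) p π ≤
      eLpNorm (fun z : X × (Fin N → Bool) => ∑ k, (boolSign (z.2 k) * h k z.1) • x k) p π := by
    refine eLpNorm_prod_mono_of_sum_sign hp0 hptop hham hhm (Eventually.of_forall fun t => ?_)
    exact sum_norm_rpow_sign_contraction hp1 x (fun k => h k t) (fun k => |h k t|)
      fun k => (abs_abs _).le
  have step6 : eLpNorm (fun z : X × (Fin N → Bool) =>
        ∑ k, (boolSign (z.2 k) * h k z.1) • x k) p π ≤
      K * eLpNorm (fun t => ∑ k, h k t • x k) p ν := by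
    rw [← fst_eq _ hhs]
    exact eLpNorm_prod_le_of_forall_fiber hp0 hptop hhm (hsm _ hhs) hhu
  refine step1.trans (mul_le_mul_right (step2.trans (step3.trans
    (mul_le_mul_right (step4.trans (mul_le_mul_right (step5.trans step6) _)) _))) _)

end Comparison

/-! ## Nested enlargements -/

/-- Sets `U i` of different sizes can be enlarged, inside `V i`, to a nested family. -/
theorem exists_nested_enlargement {X ι : Type*} [TopologicalSpace X] (F : Finset ι) (lev : ι → ℤ)
    (U V : ι → Set X) (hU : ∀ i, IsOpen (U i)) (hUV : ∀ i, U i ⊆ V i)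
    (hsame : ∀ i ∈ F, ∀ j ∈ F, i ≠ j → lev i = lev j → Disjoint (V i) (V j))
    (hfine : ∀ i ∈ F, ∀ j ∈ F, lev i < lev j → (V j ∩ U i).Nonempty → V j ⊆ V i) :
    ∃ A : ι → Set X, (∀ i ∈ F, IsOpen (A i) ∧ U i ⊆ A i ∧ A i ⊆ V i) ∧
      ∀ i ∈ F, ∀ j ∈ F, lev i ≤ lev j → i ≠ j → A j ⊆ A i ∨ Disjoint (A j) (A i) := by
  classical
  -- Each new set is at least as coarse as all the earlier ones, so the finer enlargements are final
  -- when a coarse set absorbs them.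
  induction F using Finset.induction_on_min_value lev with
  | empty => exact ⟨U, by simp, by simp⟩
  | insert a s has hmin ih =>
    obtain ⟨A, hA, hnest⟩ := ih
      (fun i hi j hj => hsame i (Finset.mem_insert_of_mem hi) j (Finset.mem_insert_of_mem hj))
      (fun i hi j hj => hfine i (Finset.mem_insert_of_mem hi) j (Finset.mem_insert_of_mem hj))
    set J : Set ι := {j | j ∈ s ∧ lev a < lev j ∧ (A j ∩ U a).Nonempty} with hJ
    set B : Set X := U a ∪ ⋃ j ∈ J, A j with hB
    have hne : ∀ i ∈ s, i ≠ a := fun i hi h => has (h ▸ hi)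
    have hBV : B ⊆ V a := by
      refine union_subset (hUV a) (iUnion₂_subset fun j hj => (hA j hj.1).2.2.trans ?_)
      exact hfine a (Finset.mem_insert_self _ _) j (Finset.mem_insert_of_mem hj.1) hj.2.1
        (hj.2.2.mono (inter_subset_inter_left _ (hA j hj.1).2.2))
    have hdisj : ∀ i ∈ s, lev i = lev a → Disjoint (A i) B := fun i hi hlev =>
      (hsame i (Finset.mem_insert_of_mem hi) a (Finset.mem_insert_self _ _) (hne i hi) hlev).mono
        (hA i hi).2.2 hBV
    -- If `A j` meets `B` without meeting `U a`, it meets an absorbed `A j'`. By nestedness it lies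
    -- in `A j'`, hence in `B`, or contains `A j'` and therefore meets `U a` after all.
    have hsub : ∀ j ∈ s, lev a < lev j → A j ⊆ B ∨ Disjoint (A j) B := by
      intro j hj hlev
      by_contra! hcon
      obtain ⟨hnsub, hndisj⟩ := hcon
      have hjJ : j ∉ J := fun h => hnsub (subset_union_of_subset_right
        (subset_biUnion_of_mem (u := A) h) _)
      obtain ⟨y, hyj, hyB⟩ := not_disjoint_iff.mp hndisj
      rcases hyB with hy | hy
      · exact hjJ ⟨hj, hlev, y, hyj, hy⟩
      · obtain ⟨j', hj', hy'⟩ := mem_iUnion₂.mp hy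
        have hjj' : j ≠ j' := fun h => hjJ (h ▸ hj')
        rcases le_total (lev j) (lev j') with hle | hle
        · rcases hnest j hj j' hj'.1 hle hjj' with h | h
          · exact hjJ ⟨hj, hlev, hj'.2.2.mono (inter_subset_inter_left _ h)⟩
          · exact disjoint_left.mp h hy' hyj
        · rcases hnest j' hj'.1 j hj hle hjj'.symm with h | h
          · exact hnsub (h.trans (subset_union_of_subset_right
              (subset_biUnion_of_mem (u := A) hj') _))
          · exact disjoint_left.mp h hyj hy'
    refine ⟨Function.update A a B, ?_, ?_⟩
    · intro i hi
      rcases Finset.mem_insert.mp hi with rfl | hi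
      · rw [Function.update_self]
        exact ⟨(hU i).union (isOpen_biUnion fun j hj => (hA j hj.1).1), subset_union_left, hBV⟩
      · rw [Function.update_of_ne (hne i hi)]
        exact hA i hi
    · intro i hi j hj hlev hij
      rcases Finset.mem_insert.mp hi with rfl | his
      · have hjs := (Finset.mem_insert.mp hj).resolve_left hij.symm
        rw [Function.update_self, Function.update_of_ne (hne j hjs)]
        rcases hlev.lt_or_eq with h | h
        · exact hsub j hjs h
        · exact Or.inr (hdisj j hjs h.symm)
      · rcases Finset.mem_insert.mp hj with rfl | hjs
        · rw [Function.update_self, Function.update_of_ne (hne i his)]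
          exact Or.inr (hdisj i his (le_antisymm hlev (hmin i his))).symm
        · rw [Function.update_of_ne (hne i his), Function.update_of_ne (hne j hjs)]
          exact hnest i his j hjs hlev hij

/-! ## Geometry of the cubes -/

section Geometry

variable {X : Type u} [TopologicalSpace X] [MeasurableSpace X]
  {d : X → X → ℝ} {μ : Measure X} {D : DyadicSystem d μ}

theorem DyadicSystem.Cube.scale_pos (A : D.Cube) : 0 < D.q ^ A.lev := zpow_pos D.q_pos _

theorem DyadicSystem.Cube.isOpen (A : D.Cube) : IsOpen A.carrier := D.isOpen_cube _ _ A.mem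

variable [BorelSpace X]

theorem IsHomogeneousType.exists_measure_qBall_le (hX : IsHomogeneousType d μ) (a : ℝ) {b : ℝ}
    (hb : 0 < b) : ∃ c : ℝ, 0 < c ∧ ∀ (x : X) (s : ℝ), 0 < s →
      μ (qBall d x (a * s)) ≤ ENNReal.ofReal c * μ (qBall d x (b * s)) := by
  obtain ⟨Cd, hCd, hdoub⟩ := hX.doubling
  obtain ⟨n, hn⟩ := pow_unbounded_of_one_lt (a / b) (one_lt_two (α := ℝ))
  have hiter : ∀ (k : ℕ) (x : X) (r : ℝ), 0 < r →
      μ (qBall d x (2 ^ k * r)) ≤ ENNReal.ofReal (Cd ^ k) * μ (qBall d x r) := by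
    intro k x r hr
    induction k with
    | zero => simp
    | succ k ih =>
      rw [pow_succ', mul_assoc, pow_succ', ENNReal.ofReal_mul hCd.le, mul_assoc]
      exact (hdoub x (2 ^ k * r) (by positivity)).2.1.trans (mul_le_mul' le_rfl ih)
  refine ⟨Cd ^ n, pow_pos hCd n, fun x s hs => ?_⟩
  refine (measure_mono fun y hy => ?_).trans (hiter n x (b * s) (mul_pos hb hs))
  have h1 : a ≤ 2 ^ n * b := ((div_lt_iff₀ hb).mp hn).le
  have h2 : a * s ≤ 2 ^ n * (b * s) := by
    rw [← mul_assoc]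
    exact mul_le_mul_of_nonneg_right h1 hs.le
  exact lt_of_lt_of_le (show d x y < a * s from hy) h2

theorem DyadicSystem.Cube.measure_pos (hX : IsHomogeneousType d μ) (A : D.Cube) :
    0 < μ A.carrier := by
  obtain ⟨Cd, -, h⟩ := hX.doubling
  have h1 := (h (D.center A.lev A.carrier) (D.C₁ * D.q ^ A.lev / 2)
    (half_pos (mul_pos D.C₁_pos A.scale_pos))).1
  rw [mul_div_cancel₀ _ two_ne_zero] at h1
  exact h1.trans_le (measure_mono (D.ball_subset _ _ A.mem))

theorem DyadicSystem.subset_diamond_self (hX : IsHomogeneousType d μ) {r : ℝ} (hr : 0 < r)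
    (A : D.Cube) : A.carrier ⊆ D.diamond r A := fun y hy =>
  ⟨y, hy, by rw [(hX.quasimetric.eq_zero_iff y y).mpr rfl]; exact mul_pos hr A.scale_pos⟩

/-- The enlargement lies in a ball about the center whose radius is a fixed multiple of that of the
inner ball of the cube; iterated doubling compares the two. -/
theorem DyadicSystem.exists_measure_diamond_le (hX : IsHomogeneousType d μ) (D : DyadicSystem d μ)
    (r : ℝ) : ∃ c : ℝ, 0 < c ∧ ∀ A : D.Cube,
      μ (D.diamond r A) ≤ ENNReal.ofReal c * μ A.carrier := by
  obtain ⟨K, hK, htri⟩ := hX.quasimetric.quasi_triangle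
  obtain ⟨c, hc, hball⟩ := hX.exists_measure_qBall_le (K * (D.C₂ + r)) D.C₁_pos
  refine ⟨c, hc, fun A => ?_⟩
  calc μ (D.diamond r A)
      ≤ μ (qBall d (D.center A.lev A.carrier) (K * (D.C₂ + r) * D.q ^ A.lev)) := by
        refine measure_mono ?_
        rintro y ⟨a, ha, hay⟩
        have h1 : d (D.center A.lev A.carrier) a < D.C₂ * D.q ^ A.lev :=
          D.subset_ball _ _ A.mem ha
        have h2 := htri (D.center A.lev A.carrier) y a
        show d (D.center A.lev A.carrier) y < K * (D.C₂ + r) * D.q ^ A.lev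
        refine h2.trans_lt ?_
        rw [mul_assoc]
        refine mul_lt_mul_of_pos_left ?_ (by linarith)
        rw [add_mul]
        exact add_lt_add h1 hay
    _ ≤ ENNReal.ofReal c * μ (qBall d (D.center A.lev A.carrier) (D.C₁ * D.q ^ A.lev)) :=
        hball _ _ A.scale_pos
    _ ≤ ENNReal.ofReal c * μ A.carrier :=
        mul_le_mul' le_rfl (measure_mono (D.ball_subset _ _ A.mem))

/-- If the levels of the pairs are sufficiently spread, the separation region of a finer pair that
meets a coarser pair lies within the separation region of the latter. -/
theorem ShiftRelation.exists_level_gap (hX : IsHomogeneousType d μ) (D : DyadicSystem d μ)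
    {CR : ℝ} (hCR : 0 < CR) : ∃ β : ℝ, 0 < β ∧ ∀ m : ℝ, 0 < m → ∀ (S : ShiftRelation D m CR)
      (ℓ : ℕ), (1 + m) * D.q ^ ℓ ≤ β →
      ∀ (k : Fin S.M) (j : Fin (S.Mk k)) (i : ℕ) (P Q P' Q' : D.Cube),
        (P, Q) ∈ S.levelBlock ℓ k j i → (P', Q') ∈ S.levelBlock ℓ k j i → P.lev < P'.lev →
        ((D.diamond CR P' ∪ D.diamond CR Q') ∩ (P.carrier ∪ Q.carrier)).Nonempty →
        D.diamond CR P' ∪ D.diamond CR Q' ⊆ D.diamond CR P ∪ D.diamond CR Q := by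
  obtain ⟨K, hK, htri⟩ := hX.quasimetric.quasi_triangle
  have hK0 : 0 < K := by linarith
  have hC₂ := D.C₂_pos
  set ρ : ℝ := D.C₂ + 1 + CR with hρ
  have hρ0 : 0 < ρ := by positivity
  -- The finer region has radius less than `K² ρ (1 + m) s'` about `z`; two points of it are thus at
  -- distance less than `2 K³ ρ (1 + m) s'`, which must not exceed `CR * s`.
  refine ⟨CR / (2 * K ^ 3 * ρ), by positivity, ?_⟩
  intro m hm S ℓ hℓ k j i P Q P' Q' hPQ hPQ' hlev hne
  have hG : ∀ {R R' : D.Cube}, (R, R') ∈ S.levelBlock ℓ k j i → (R, R') ∈ S.τ := fun h => by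
    rw [← S.part_union]
    refine mem_iUnion.mpr ⟨k, ?_⟩
    rw [← S.G_union]
    exact mem_iUnion.mpr ⟨j, h.1⟩
  have hlevQ := S.same_level _ _ (hG hPQ)
  have hlevQ' := S.same_level _ _ (hG hPQ')
  set s := D.q ^ P.lev with hs
  set s' := D.q ^ P'.lev with hs'
  have hs0 : 0 < s := P.scale_pos
  have hs'0 : 0 < s' := P'.scale_pos
  -- Distinct levels in one residue class modulo `ℓ` differ by at least `ℓ`.
  have hss' : s' ≤ D.q ^ ℓ * s := by
    obtain ⟨-, r, hr, -⟩ := hPQ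
    obtain ⟨-, r', hr', -⟩ := hPQ'
    simp only at hr hr'
    have hrr : r + 1 ≤ r' := by
      by_contra hcon
      have : r' * ℓ ≤ r * ℓ := mul_le_mul_of_nonneg_right (by omega) (by positivity)
      omega
    have h1 : (r + 1) * ℓ ≤ r' * (ℓ : ℤ) := mul_le_mul_of_nonneg_right hrr (by positivity)
    have h2 : (ℓ : ℤ) + P.lev ≤ P'.lev := by rw [hr, hr']; linarith
    calc s' ≤ D.q ^ ((ℓ : ℤ) + P.lev) :=
          zpow_le_zpow_right_of_le_one₀ D.q_pos D.q_lt_one.le h2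
      _ = D.q ^ ℓ * s := by rw [zpow_add₀ D.q_pos.ne', zpow_natCast]
  set z := D.center P'.lev P'.carrier
  have hP'z : ∀ w ∈ P'.carrier, d z w < D.C₂ * s' := fun w hw => D.subset_ball _ _ P'.mem hw
  have hpair : ∀ w ∈ P'.carrier ∪ Q'.carrier, d z w < K * ((D.C₂ + m) * s') := by
    have hlow : D.C₂ * s' ≤ K * ((D.C₂ + m) * s') := by
      calc D.C₂ * s' ≤ (D.C₂ + m) * s' := by gcongr; linarith
        _ ≤ K * ((D.C₂ + m) * s') := le_mul_of_one_le_left (by positivity) hK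
    rintro w (hw | hw)
    · exact (hP'z w hw).trans_le hlow
    · obtain ⟨a, ha, haw⟩ := S.subset_diamond _ _ (hG hPQ') hw
      refine (htri z w a).trans_lt (mul_lt_mul_of_pos_left ?_ hK0)
      rw [add_mul]
      exact add_lt_add (hP'z a ha) haw
  have hball : ∀ w ∈ D.diamond CR P' ∪ D.diamond CR Q', d z w < K ^ 2 * ρ * (1 + m) * s' := by
    intro w hw
    have hex : ∃ a ∈ P'.carrier ∪ Q'.carrier, d a w < CR * s' := by
      rcases hw with ⟨a, ha, haw⟩ | ⟨a, ha, haw⟩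
      · exact ⟨a, Or.inl ha, haw⟩
      · exact ⟨a, Or.inr ha, by rwa [← hlevQ'] at haw⟩
    obtain ⟨a, ha, haw⟩ := hex
    calc d z w ≤ K * (d z a + d a w) := htri z w a
      _ < K * (K * ((D.C₂ + m) * s') + CR * s') :=
        mul_lt_mul_of_pos_left (add_lt_add (hpair a ha) haw) hK0
      _ ≤ K * (K * ((D.C₂ + m) * s') + K * (CR * s')) := by
        exact mul_le_mul_of_nonneg_left
          (add_le_add le_rfl (le_mul_of_one_le_left (by positivity) hK)) hK0.le
      _ = K ^ 2 * (D.C₂ + m + CR) * s' := by ring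
      _ ≤ K ^ 2 * (ρ * (1 + m)) * s' := by
        gcongr
        rw [hρ]
        nlinarith [mul_pos hC₂ hm, mul_pos hCR hm]
      _ = K ^ 2 * ρ * (1 + m) * s' := by ring
  obtain ⟨y, hy', hy⟩ := hne
  intro w hw
  -- The point `y` lies in one of the coarser cubes, so any `w` this close to it lies in the diamond
  -- of that same cube.
  have hyw : d y w < CR * s := by
    calc d y w ≤ K * (d y z + d z w) := htri y w z
      _ < K * (K ^ 2 * ρ * (1 + m) * s' + K ^ 2 * ρ * (1 + m) * s') := by
        rw [hX.quasimetric.symm y z]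
        exact mul_lt_mul_of_pos_left (add_lt_add (hball y hy') (hball w hw)) hK0
      _ = 2 * K ^ 3 * ρ * ((1 + m) * s') := by ring
      _ ≤ 2 * K ^ 3 * ρ * ((1 + m) * (D.q ^ ℓ * s)) := by gcongr
      _ = 2 * K ^ 3 * ρ * ((1 + m) * D.q ^ ℓ) * s := by ring
      _ ≤ 2 * K ^ 3 * ρ * (CR / (2 * K ^ 3 * ρ)) * s := by gcongr
      _ = CR * s := by field_simp
  rcases hy with hy | hy
  · exact Or.inl ⟨y, hy, hyw⟩
  · exact Or.inr ⟨y, hy, by rwa [← hlevQ]⟩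

end Geometry

/-! ## Boundedness of the shift -/

section Shift

variable {E : Type v} [NormedAddCommGroup E]

theorem eLpNorm_cond_of_support {X : Type u} [MeasurableSpace X] {μ : Measure X} {W : Set X}
    {p : ℝ≥0∞} (hp : p ≠ ∞) {f : X → E} (hf : ∀ t ∉ W, f t = 0) :
    eLpNorm f p μ[|W] = (μ W)⁻¹ ^ (1 / p).toReal * eLpNorm f p μ := by
  rw [ProbabilityTheory.cond, eLpNorm_smul_measure_of_ne_top hp, smul_eq_mul,
    eLpNorm_restrict_eq_of_support_subset]
  intro t ht
  by_contra h
  exact ht (hf t h)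

variable [NormedSpace ℝ E] {X : Type u} [TopologicalSpace X] [MeasurableSpace X] [BorelSpace X]
  {d : X → X → ℝ} {μ : Measure X} {D : DyadicSystem d μ} {m CR Ch : ℝ} {S : ShiftRelation D m CR}

theorem HaarSystem.enorm_sum_vec (hX : IsHomogeneousType d μ) (H : HaarSystem S Ch) (p : ℝ≥0∞)
    {ι : Type*} (s : Finset ι) (P : ι → D.Cube) (x : ι → E) :
    ‖∑ n ∈ s, H.vec hX p (P n) (x n)‖ₑ = eLpNorm (fun t => ∑ n ∈ s, H.h (P n) t • x n) p μ := by
  rw [Lp.enorm_def]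
  refine eLpNorm_congr_ae ?_
  refine (Lp.coeFn_fun_finsetSum s fun n => H.vec hX p (P n) (x n)).trans ?_
  have h1 : ∀ᵐ t ∂μ, ∀ n ∈ s, H.vec hX p (P n) (x n) t = H.h (P n) t • x n :=
    (Finset.eventually_all s).mpr fun n _ => (H.memLp_smul hX p (P n) (x n)).coeFn_toLp
  filter_upwards [h1] with t ht
  exact Finset.sum_congr rfl ht

variable [CompleteSpace E]

/-- The norm inequality for a finite family of pairs, enumerated from coarse to fine. -/
theorem HaarSystem.enorm_sum_vec_le (hX : IsHomogeneousType d μ) (H : HaarSystem S Ch)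
    (hCR : 0 < CR) (hCh : 0 < Ch) {p : ℝ≥0∞} (hp : 1 ≤ p) (hptop : p ≠ ∞) {C : ℝ≥0}
    (hC : HasUMDConstant.{u, v} E p C) {c : ℝ} (hc : 0 < c)
    (hmeas : ∀ A : D.Cube, μ (D.diamond CR A) ≤ ENNReal.ofReal c * μ A.carrier)
    {k : Fin S.M} {j : Fin (S.Mk k)} {N : ℕ} {P Q : Fin N → D.Cube}
    (hPQ : ∀ n, (P n, Q n) ∈ S.G k j) (hinj : Function.Injective P)
    (hmono : Monotone fun n => (P n).lev)
    (hgap : ∀ n n', (P n).lev < (P n').lev →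
      ((D.diamond CR (P n') ∪ D.diamond CR (Q n')) ∩
        ((P n).carrier ∪ (Q n).carrier)).Nonempty →
      D.diamond CR (P n') ∪ D.diamond CR (Q n') ⊆ D.diamond CR (P n) ∪ D.diamond CR (Q n))
    (x : Fin N → E) :
    ‖∑ n, H.vec hX p (Q n) (x n)‖ₑ ≤
      (1 + 2 * C) * (ENNReal.ofReal (Ch * c) * ((1 + C) * (1 + 2 * C))) *
        ‖∑ n, H.vec hX p (P n) (x n)‖ₑ := by
  rw [H.enorm_sum_vec, H.enorm_sum_vec]
  rcases Nat.eq_zero_or_pos N with rfl | hN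
  · simp
  have hpart : ∀ n, (P n, Q n) ∈ S.part k := fun n => by
    rw [← S.G_union]
    exact mem_iUnion.mpr ⟨j, hPQ n⟩
  have hτ : ∀ n, (P n, Q n) ∈ S.τ := fun n => by
    rw [← S.part_union]
    exact mem_iUnion.mpr ⟨k, hpart n⟩
  have hQinj : Function.Injective Q := fun n n' h =>
    hinj (S.part_injective k _ _ (Q n) (hpart n) (h ▸ hpart n'))
  obtain ⟨A, hA, hnest⟩ := exists_nested_enlargement (Finset.univ : Finset (Fin N))
    (fun n => (P n).lev) (fun n => (P n).carrier ∪ (Q n).carrier)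
    (fun n => D.diamond CR (P n) ∪ D.diamond CR (Q n))
    (fun n => (P n).isOpen.union (Q n).isOpen)
    (fun n => union_subset_union (D.subset_diamond_self hX hCR _) (D.subset_diamond_self hX hCR _))
    (fun n _ n' _ hne hlev => by
      have hsep := S.separated k j _ _ _ _ (hPQ n) (hPQ n') (hinj.ne hne) hlev
      simp only [← disjoint_iff_inter_eq_empty] at hsep
      exact disjoint_union_left.mpr
        ⟨disjoint_union_right.mpr
          ⟨hsep _ _ (Or.inl rfl) (Or.inl rfl), hsep _ _ (Or.inl rfl) (Or.inr rfl)⟩,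
        disjoint_union_right.mpr
          ⟨hsep _ _ (Or.inr rfl) (Or.inl rfl), hsep _ _ (Or.inr rfl) (Or.inr rfl)⟩⟩)
    (fun n _ n' _ => hgap n n')
  have hAm : ∀ n, MeasurableSet (A n) := fun n => (hA n (Finset.mem_univ _)).1.measurableSet
  have hPA : ∀ n, (P n).carrier ⊆ A n := fun n =>
    subset_union_left.trans (hA n (Finset.mem_univ _)).2.1
  have hQA : ∀ n, (Q n).carrier ⊆ A n := fun n =>
    subset_union_right.trans (hA n (Finset.mem_univ _)).2.1
  have hAnest : ∀ n n', n ≤ n' → A n' ⊆ A n ∨ Disjoint (A n') (A n) := fun n n' h => by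
    by_cases hne : n = n'
    · exact Or.inl (hne ▸ le_rfl)
    · exact hnest n (Finset.mem_univ _) n' (Finset.mem_univ _) (hmono h) hne
  -- This matches the denominator `|P| + |Q|` of the Haar size condition, so averages over `A n`
  -- dominate `h_Q` up to `Ch * c`.
  have hAle : ∀ n, μ (A n) ≤ ENNReal.ofReal c * (μ (P n).carrier + μ (Q n).carrier) := fun n => by
    rw [mul_add]
    exact (measure_mono (hA n (Finset.mem_univ _)).2.2).trans
      ((measure_union_le _ _).trans (add_le_add (hmeas _) (hmeas _)))
  have hAtop : ∀ n, μ (A n) ≠ ∞ := fun n => ne_top_of_le_ne_top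
    (ENNReal.mul_ne_top ENNReal.ofReal_ne_top (ENNReal.add_ne_top.mpr
      ⟨(P n).measure_ne_top hX, (Q n).measure_ne_top hX⟩)) (hAle n)
  have hA0 : ∀ n, μ (A n) ≠ 0 := fun n =>
    (((P n).measure_pos hX).trans_le (measure_mono (hPA n))).ne'
  set W : Set X := ⋃ n, A n with hW
  have hAW : ∀ n, A n ⊆ W := subset_iUnion A
  have hWm : MeasurableSet W := MeasurableSet.iUnion hAm
  have hW0 : μ W ≠ 0 := fun h => hA0 ⟨0, hN⟩ (measure_mono_null (hAW _) h)
  have hWtop : μ W ≠ ∞ := ((measure_iUnion_le A).trans_lt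
    (by rw [tsum_fintype]; exact ENNReal.sum_lt_top.mpr fun n _ => (hAtop n).lt_top)).ne
  have hPsupp : ∀ n, ∀ t ∉ A n, H.h (P n) t = 0 := fun n t ht => by
    by_contra h
    exact ht (hPA n (H.support_subset _ h))
  have hQsupp : ∀ n, ∀ t ∉ A n, H.h (Q n) t = 0 := fun n t ht => by
    by_contra h
    exact ht (hQA n (H.support_subset _ h))
  have hPW : ∀ n, ∀ t ∉ W, H.h (P n) t = 0 := fun n t ht => hPsupp n t fun h => ht (hAW n h)
  have hQW : ∀ n, ∀ t ∉ W, H.h (Q n) t = 0 := fun n t ht => hQsupp n t fun h => ht (hAW n h)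
  have : IsProbabilityMeasure μ[|W] := cond_isProbabilityMeasure_of_finite hW0 hWtop
  have hLptop : ∀ R : D.Cube, MemLp (H.h R) ∞ μ[|W] := fun R =>
    ((H.bounded R).mono_measure Measure.restrict_le_self).smul_measure (ENNReal.inv_ne_top.mpr hW0)
  have hLp : ∀ R : D.Cube, MemLp (H.h R) p μ[|W] := fun R => (hLptop R).mono_exponent le_top
  have hcond : ∀ n, μ[|W] (A n) = (μ W)⁻¹ * μ (A n) := fun n => by
    rw [cond_apply hWm, inter_eq_right.mpr (hAW n)]
  have hdom : ∀ n, ∀ᵐ t ∂μ[|W], |H.h (Q n) t| ≤ (Ch * c) * (A n).indicator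
      (fun _ => (μ[|W].real (A n))⁻¹ * ∫ t, |H.h (P n) t| ∂μ[|W]) t := by
    intro n
    set J : ℝ := ∫ t, |H.h (P n) t| ∂μ with hJ
    have hJ0 : 0 ≤ J := integral_nonneg fun t => abs_nonneg _
    have hsum0 : 0 < μ.real (P n).carrier + μ.real (Q n).carrier :=
      add_pos_of_pos_of_nonneg (ENNReal.toReal_pos ((P n).measure_pos hX).ne'
        ((P n).measure_ne_top hX)) measureReal_nonneg
    have hAr : 0 < μ.real (A n) := ENNReal.toReal_pos (hA0 n) (hAtop n)
    have hArle : μ.real (A n) ≤ c * (μ.real (P n).carrier + μ.real (Q n).carrier) := by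
      have h1 := ENNReal.toReal_mono (ENNReal.mul_ne_top ENNReal.ofReal_ne_top
        (ENNReal.add_ne_top.mpr ⟨(P n).measure_ne_top hX, (Q n).measure_ne_top hX⟩)) (hAle n)
      rwa [ENNReal.toReal_mul, ENNReal.toReal_ofReal hc.le,
        ENNReal.toReal_add ((P n).measure_ne_top hX) ((Q n).measure_ne_top hX)] at h1
    have havg : (μ[|W].real (A n))⁻¹ * ∫ t, |H.h (P n) t| ∂μ[|W] = (μ.real (A n))⁻¹ * J := by
      have h1 := setIntegral_cond (μ := μ) (W := W) MeasurableSet.univ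
        (f := fun t => |H.h (P n) t|) (fun t ht => by simp [hPW n t ht])
      rw [setIntegral_univ, setIntegral_univ, smul_eq_mul] at h1
      have hWr : μ.real W ≠ 0 := (ENNReal.toReal_pos hW0 hWtop).ne'
      have h2 : μ[|W].real (A n) = (μ.real W)⁻¹ * μ.real (A n) := by
        simp only [measureReal_def, hcond n, ENNReal.toReal_mul, ENNReal.toReal_inv]
      rw [h1, h2, ← hJ]
      field_simp
    have hae : ∀ᵐ t ∂μ, |H.h (Q n) t| ≤ Ch * c * ((μ.real (A n))⁻¹ * J) := by
      filter_upwards [enorm_ae_le_eLpNormEssSup (H.h (Q n)) μ] with t ht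
      rw [← eLpNorm_exponent_top] at ht
      have h1 := ht.trans (H.norm_le _ _ (hτ n))
      rw [Real.enorm_eq_ofReal_abs, ENNReal.ofReal_le_ofReal_iff (by positivity)] at h1
      refine h1.trans ?_
      rw [mul_assoc Ch, mul_assoc Ch, ← mul_assoc c]
      refine mul_le_mul_of_nonneg_left (mul_le_mul_of_nonneg_right ?_ hJ0) hCh.le
      rw [← div_eq_mul_inv, div_le_div_iff₀ hsum0 hAr]
      linarith
    filter_upwards [cond_absolutelyContinuous.ae_le hae] with t ht
    by_cases htA : t ∈ A n
    · rw [indicator_of_mem htA, havg]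
      exact ht
    · rw [indicator_of_notMem htA, hQsupp n t htA, abs_zero, mul_zero]
  have hPu : ∀ ω : Fin N → Bool,
      eLpNorm (fun t => ∑ n, (boolSign (ω n) * H.h (P n) t) • x n) p μ[|W] ≤
        (1 + 2 * C) * eLpNorm (fun t => ∑ n, H.h (P n) t • x n) p μ[|W] := fun ω =>
    hC.eLpNorm_sign_sum_le_of_isMartingaleDifferenceFamily hp (H.mds_fst k) H.measurable hW0 hWtop
      hinj (fun n => ⟨Q n, hpart n⟩) hPW (fun n => hLp _) x fun n => boolSign_eq (ω n)
  have hQu : ∀ ω : Fin N → Bool, eLpNorm (fun t => ∑ n, H.h (Q n) t • x n) p μ[|W] ≤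
      (1 + 2 * C) * eLpNorm (fun t => ∑ n, (boolSign (ω n) * H.h (Q n) t) • x n) p μ[|W] := by
    intro ω
    -- Here the signs must be removed, not inserted: they are put into the coefficients, and
    -- multiplying by them once more cancels them.
    have h1 := hC.eLpNorm_sign_sum_le_of_isMartingaleDifferenceFamily hp (H.mds_snd k) H.measurable
      hW0 hWtop hQinj (fun n => ⟨P n, hpart n⟩) hQW (fun n => hLp _)
      (fun n => boolSign (ω n) • x n) fun n => boolSign_eq (ω n)
    have hsq : ∀ b, boolSign b * boolSign b = 1 := fun b => by
      rcases boolSign_eq b with h | h <;> rw [h] <;> norm_num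
    have e1 : ∀ n t, (boolSign (ω n) * H.h (Q n) t) • boolSign (ω n) • x n =
        H.h (Q n) t • x n := fun n t => by
      rw [smul_smul, mul_right_comm, hsq, one_mul]
    have e2 : ∀ n t, H.h (Q n) t • boolSign (ω n) • x n =
        (boolSign (ω n) * H.h (Q n) t) • x n := fun n t => by
      rw [smul_smul, mul_comm]
    simpa only [e1, e2] using h1
  have key := hC.eLpNorm_sum_le_of_dominated hp hptop hAm hAnest
    (fun n => by rw [hcond]; exact mul_ne_zero (ENNReal.inv_ne_zero.mpr hWtop) (hA0 n))
    (fun n => hLp (Q n)) (fun n => hLp (P n)) hPsupp (mul_nonneg hCh.le hc.le) hdom x hQu hPu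
  have hsumW : ∀ R : Fin N → D.Cube, (∀ n, ∀ t ∉ W, H.h (R n) t = 0) →
      ∀ t ∉ W, ∑ n, H.h (R n) t • x n = 0 := fun R hR t ht =>
    Finset.sum_eq_zero fun n _ => by rw [hR n t ht, zero_smul]
  rw [eLpNorm_cond_of_support hptop (hsumW Q hQW), eLpNorm_cond_of_support hptop (hsumW P hPW)]
    at key
  -- Both sides carry the same normalizing factor, so the constant does not depend on `W`.
  set γ : ℝ≥0∞ := (μ W)⁻¹ ^ (1 / p).toReal
  have hγ0 : γ ≠ 0 := (ENNReal.rpow_pos (ENNReal.inv_pos.mpr hWtop)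
    (ENNReal.inv_ne_top.mpr hW0)).ne'
  have hγtop : γ ≠ ∞ := ENNReal.rpow_ne_top_of_nonneg ENNReal.toReal_nonneg
    (ENNReal.inv_ne_top.mpr hW0)
  rw [← ENNReal.mul_le_mul_iff_right hγ0 hγtop]
  refine key.trans (le_of_eq ?_)
  ring

theorem HaarSystem.norm_sum_shiftVec_le (hX : IsHomogeneousType d μ) (H : HaarSystem S Ch)
    (hCR : 0 < CR) (hCh : 0 < Ch) {p : ℝ≥0∞} [Fact (1 ≤ p)] (hptop : p ≠ ∞) {C : ℝ≥0}
    (hC : HasUMDConstant.{u, v} E p C) {c : ℝ} (hc : 0 < c)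
    (hmeas : ∀ A : D.Cube, μ (D.diamond CR A) ≤ ENNReal.ofReal c * μ A.carrier)
    {ℓ : ℕ} {k : Fin S.M} {j : Fin (S.Mk k)} {i : ℕ}
    (hgap : ∀ P Q P' Q' : D.Cube,
      (P, Q) ∈ S.levelBlock ℓ k j i → (P', Q') ∈ S.levelBlock ℓ k j i → P.lev < P'.lev →
      ((D.diamond CR P' ∪ D.diamond CR Q') ∩ (P.carrier ∪ Q.carrier)).Nonempty →
      D.diamond CR P' ∪ D.diamond CR Q' ⊆ D.diamond CR P ∪ D.diamond CR Q)
    (F : Finset D.Cube) (x : D.Cube → E) (hF : ∀ P ∈ F, P ∈ proj₁ (S.levelBlock ℓ k j i)) :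
    ‖∑ P ∈ F, H.shiftVec hX p k P (x P)‖ ≤
      (1 + 2 * C) * (Ch * c * ((1 + C) * (1 + 2 * C))) * ‖∑ P ∈ F, H.vec hX p P (x P)‖ := by
  let e₀ := F.equivFin
  let σ := Tuple.sort fun n => (e₀.symm n : D.Cube).lev
  let e : Fin F.card ≃ F := σ.trans e₀.symm
  have hmono : Monotone fun n => (e n : D.Cube).lev :=
    Tuple.monotone_sort fun n => (e₀.symm n : D.Cube).lev
  choose Q hQ using fun n => hF (e n) (e n).2
  have hpart : ∀ n, ((e n : D.Cube), Q n) ∈ S.part k := fun n => by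
    rw [← S.G_union]
    exact mem_iUnion.mpr ⟨j, (hQ n).1⟩
  have hsum : ∀ f : D.Cube → Lp E p μ, ∑ P ∈ F, f P = ∑ n, f (e n) := fun f => by
    rw [← Finset.sum_coe_sort, ← Equiv.sum_comp e]
  have key := H.enorm_sum_vec_le hX hCR hCh (Fact.out : 1 ≤ p) hptop hC hc hmeas
    (fun n => (hQ n).1) (Subtype.val_injective.comp e.injective) hmono
    (fun n n' => hgap _ _ _ _ (hQ n) (hQ n')) (fun n => x (e n))
  rw [hsum, hsum]
  simp only [H.shiftVec_eq hX p k _ _ (hpart _)]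
  have h2 := ENNReal.toReal_mono ?_ key
  · simpa [ENNReal.toReal_mul, ENNReal.toReal_add, ENNReal.toReal_ofReal (mul_pos hCh hc).le,
      ENNReal.mul_eq_top] using h2
  · finiteness

/-- A bound on finite sums extends to unconditionally convergent series. -/
theorem exists_hasSum_of_norm_sum_le {α V : Type*} [NormedAddCommGroup V] [CompleteSpace V]
    {a b : α → V} {K : ℝ} (hK : 0 < K)
    (hab : ∀ F : Finset α, ‖∑ i ∈ F, b i‖ ≤ K * ‖∑ i ∈ F, a i‖) {s : V} (ha : HasSum a s) :
    ∃ t, HasSum b t ∧ ‖t‖ ≤ K * ‖s‖ := by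
  -- The finite bound turns the Cauchy criterion for `a` at `ε / K` into that for `b` at `ε`.
  have hb : Summable b := by
    rw [summable_iff_vanishing_norm]
    intro ε hε
    obtain ⟨F, hF⟩ := summable_iff_vanishing_norm.mp ha.summable (ε / K) (div_pos hε hK)
    refine ⟨F, fun G hG => (hab G).trans_lt ?_⟩
    exact (lt_div_iff₀' hK).mp (hF G hG)
  obtain ⟨t, ht⟩ := hb
  exact ⟨t, ht, le_of_tendsto_of_tendsto' (Tendsto.norm ht) ((Tendsto.norm ha).const_mul K) hab⟩

end Shift

theorem theorem4p2 {X : Type u} [TopologicalSpace X] [MeasurableSpace X] [BorelSpace X]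
    (d : X → X → ℝ) (μ : Measure X) (hX : IsHomogeneousType d μ)
    (D : DyadicSystem d μ) (CR : ℝ) (hCR : 0 < CR) :
    ∃ β : ℝ, 0 < β ∧
      ∀ (E : Type v) [NormedAddCommGroup E] [NormedSpace ℝ E] [CompleteSpace E],
        IsUMD.{u, v} E →
      ∀ (p : ℝ≥0∞) [Fact (1 ≤ p)], 1 < p → p < ∞ →
      ∀ Ch : ℝ, 0 < Ch →
      ∃ C : ℝ, 0 < C ∧
        ∀ (m : ℝ), 0 < m →
        ∀ (S : ShiftRelation D m CR) (H : HaarSystem S Ch) (ℓ : ℕ), 0 < ℓ →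
          (1 + m) * D.q ^ ℓ ≤ β →
          ∀ (k : Fin S.M) (j : Fin (S.Mk k)) (i : ℕ), i < ℓ →
            -- on finite sums `∑ h_P x_P`, `P` in the first projection of `ℋ^{(ℓ)}_{k,j,i}`
            (∀ (F : Finset D.Cube) (x : D.Cube → E),
              (∀ P ∈ F, P ∈ proj₁ (S.levelBlock ℓ k j i)) →
              ‖∑ P ∈ F, H.shiftVec hX p k P (x P)‖ ≤ C * ‖∑ P ∈ F, H.vec hX p P (x P)‖) ∧
            -- on the space `H^{(ℓ)}_{k,j,i}`
            (∀ f ∈ H.haarSpace hX p E (proj₁ (S.levelBlock ℓ k j i)),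
              ∃ Tf : Lp E p μ,
                HasSum (fun P : proj₁ (S.levelBlock ℓ k j i) =>
                  H.shiftVec hX p k (P : D.Cube) (H.coeff f P)) Tf ∧
                ‖Tf‖ ≤ C * ‖f‖) := by
  -- Both `β` and `c` come from the geometry alone, before `E`, `p` and `Ch` are chosen.
  obtain ⟨β, hβ, hgap⟩ := ShiftRelation.exists_level_gap hX D hCR
  obtain ⟨c, hc, hmeas⟩ := D.exists_measure_diamond_le hX CR
  refine ⟨β, hβ, fun E _ _ _ hE p _ hp1 hptop Ch hCh => ?_⟩
  obtain ⟨C, hC⟩ := hE p hp1 hptop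
  refine ⟨(1 + 2 * C) * (Ch * c * ((1 + C) * (1 + 2 * C))), by positivity, ?_⟩
  intro m hm S H ℓ _ hℓ k j i _
  have hfin := fun (F : Finset D.Cube) (x : D.Cube → E) =>
    H.norm_sum_shiftVec_le hX hCR hCh hptop.ne hC hc hmeas (hgap m hm S ℓ hℓ k j i) F x
  refine ⟨hfin, fun f hf => exists_hasSum_of_norm_sum_le (by positivity) (fun G => ?_) hf⟩
  have h1 := hfin (G.map (Function.Embedding.subtype _)) (H.coeff f) fun P hP => by
    obtain ⟨R, -, rfl⟩ := Finset.mem_map.mp hP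
    exact R.2
  simpa only [Finset.sum_map, Function.Embedding.subtype_apply] using h1
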